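/- Let $\Gamma$ be a finite simple graph with vertex set $V$, let $A_\Gamma$ be the right-angled Artin group with generating set $V$ (two generators commute exactly when they are equal or adjacent), and put $V^\pm=\{v,v^{-1}\mid v\in V\}$. Write $lk(v)$ for the set of neighbours of $v$ and $st(v)=lk(v)\cup\{v\}$; write $v\le w$ if $lk(v)\subseteq st(w)$, and $v\sim w$ if $v\le w\le v$. These notions are applied to elements of $V^\pm$ through the underlying vertices. **Whitehead partitions.** A $\Gamma$-Whitehead pair is a pair $(P,m)$ where $P\subseteq V^\pm$ has at least two elements, $m\in P$, $m^{-1}\notin P$, and (i) no element of $P$ is adjacent to $m$; (ii) if $x\in P$ and $x^{-1}\notin P$, then $x\le m$; (iii) if $v,v^{-1}\in P$, then $w,w^{-1}\in P$ for all $w$ in the component of $v$ in $\Gamma\setminus st(m)$. Put $lk(P)=lk(m)^\pm$, $P^*=V^\pm\setminus(P\cup lk(P))$; these depend only on $P$. The triple $\mathbf P=\{P,lk(P),P^*\}$ is a $\Gamma$-Whitehead partition with sides $P$ and $P^*$. A vertex $v\in V$ is a singleton of $\mathbf P$ if $v$ and $v^{-1}$ lie in different sides; $v$ is in $lk(\mathbf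 P)$ if $v^{\pm1}\in lk(P)$; and $max(\mathbf P)$ is the set of $v\in V$ such that $x=v$ or $x=v^{-1}$ satisfies $x\in P$, $x^{-1}\notin P$, $x\sim m$. Two partitions $\mathbf P,\mathbf Q$ commute if every vertex of $max(\mathbf P)$ is adjacent in $\Gamma$ to every vertex of $max(\mathbf Q)$. They are compatible if they commute or some side of $\mathbf P$ is disjoint from some side of $\mathbf Q$. **The blowup.** Let $\mathcal P=\{\mathbf P_1,\dots,\mathbf P_k\}$ be a set of $k\ge 0$ distinct, pairwise compatible $\Gamma$-Whitehead partitions. A region is a choice $R=(P_1^\times,\dots,P_k^\times)$ of sides $P_i^\times\in\{P_i,P_i^*\}$ such that, for $i\ne j$, either $\mathbf P_i,\mathbf P_j$ commute or $P_i^\times\cap P_j^\times\neq\emptyset$. Put $I(R)=\bigcap_i (P_i^\times\cup lk(P_i))$ (so $I(R)=V^\pm$ if $k=0$). The vertices of the cube complex $\mathbb S^{\mathcal P}$ are the points $x_R$, one for each region $R$. There is an edge with label $e_{\mathbf P_i}$ between $x_R$ and $x_{R'}$ whenever the regions $R,R'$ differ exactly in the side of $\mathbf P_i$. For every $v\in V$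 and every region $R$ with $v^{-1}\in I(R)$, there is an edge with label $e_v$ directed from $x_R$ to $x_{R_v}$, where the region $R_v$ is obtained from $R$ by switching the sides of all the $\mathbf P_i$ of which $v$ is a singleton (it is a loop if there are none). The following pairs of labels commute: $e_v,e_w$ with $v,w$ adjacent in $\Gamma$; $e_v,e_{\mathbf P_i}$ with $v\in lk(\mathbf P_i)$; $e_{\mathbf P_i},e_{\mathbf P_j}$ with $i\neq j$ and $\mathbf P_i,\mathbf P_j$ commuting. Any $m$ edges at a vertex with pairwise commuting labels form a corner of the $1$-skeleton of an $m$-cube whose parallel edges have the same label, and one $m$-cube is glued in along each such $1$-skeleton. The complex $\mathbb S^{\mathcal P}$ carries the length metric in which every cube is a Euclidean unit cube. A hyperplane is an equivalence class of edges under the equivalence relation generated by being opposite edges of a square; it is dual to the edges in the class. **Theorem.** The blowup $\mathbb S^{\mathcal P}$ has the following properties. 1. Any two vertices $x_R,x_{R'}$ are connected by an edge path all of whose labels lie in $\{e_{\mathbf P_i}\mid R\text{ and }R'\text{ contain opposite sides of }\mathbf P_i\}$. 2. Any two edges with the same label are dual to the same hyperplane. 3. $\mathbb S^{\mathcal P}$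 is connected and locally CAT(0), i.e. every point is the centre of a ball of positive radius that is a CAT(0) space in the induced metric. -/

import Mathlib

universe u v

/-! ## CAT(0) geometry -/

section CAT0

variable {Y : Type u} [PseudoEMetricSpace Y]

/-- `γ`, restricted to `[0,1]`, is a geodesic segment from `x` to `y`, parametrised
proportionally to arc length. -/
structure IsGeodesicSegment (γ : ℝ → Y) (x y : Y) : Prop where
  source : γ 0 = x
  target : γ 1 = y
  edist_eq : ∀ s ∈ Set.Icc (0 : ℝ) 1, ∀ t ∈ Set.Icc (0 : ℝ) 1,
    edist (γ s) (γ t) = edist s t * edist x y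

/-- `Y` is a CAT(0) space: a metric space (distances are finite, and distinct points have
nonzero distance), any two points of which are joined by a geodesic segment, and in which
geodesic triangles are no fatter than their comparison triangles in the Euclidean plane: for
points `p ∈ [x,y]` and `q ∈ [x,z]` with comparison points `p' ∈ [x',y']` and `q' ∈ [x',z']`
one has `d(p,q) ≤ |p' - q'|`. -/
structure IsCAT0 (Y : Type u) [PseudoEMetricSpace Y] : Prop where
  edist_ne_top : ∀ x y : Y, edist x y ≠ ⊤
  eq_of_edist_eq_zero : ∀ x y : Y, edist x y = 0 → x = y
  exists_geodesic : ∀ x y : Y, ∃ γ : ℝ → Y, IsGeodesicSegment γ x y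
  comparison : ∀ (x y z : Y) (γ δ : ℝ → Y),
    IsGeodesicSegment γ x y → IsGeodesicSegment δ x z →
    ∀ x' y' z' : EuclideanSpace ℝ (Fin 2),
      edist x' y' = edist x y → edist x' z' = edist x z → edist y' z' = edist y z →
      ∀ s ∈ Set.Icc (0 : ℝ) 1, ∀ t ∈ Set.Icc (0 : ℝ) 1,
        edist (γ s) (δ t) ≤ edist (AffineMap.lineMap x' y' s) (AffineMap.lineMap x' z' t)

/-- `Y` is locally CAT(0) (non-positively curved): every point is the centre of a ball of
positive radius which is a CAT(0) space for the induced metric. -/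
def IsLocallyCAT0 (Y : Type u) [PseudoEMetricSpace Y] : Prop :=
  ∀ x : Y, ∃ r : ENNReal, 0 < r ∧ IsCAT0 (Metric.eball x r)

end CAT0

/-! ## Cube complexes with directed, labelled edges -/

/-- Combinatorial data of a cube complex whose edges are directed and labelled by `L`, in such
a way that parallel edges of a cube have the same direction and the same label, and
non-parallel edges of a cube have different labels. A cube `c` has one coordinate for each label in
`dir c`; for `a ∈ dir c`, the two faces of `c` on which the coordinate `a` is `0`, resp. `1`, are
`face c a _ false`, resp. `face c a _ true`. Faces may coincide, so that edges may be loops. -/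
structure LabelledCubeComplex (L : Type u) [DecidableEq L] where
  Cell : Type v
  dir : Cell → Finset L
  face : (c : Cell) → (a : L) → a ∈ dir c → Bool → Cell
  dir_face : ∀ (c : Cell) (a : L) (ha : a ∈ dir c) (ε : Bool), dir (face c a ha ε) = (dir c).erase a
  face_face : ∀ (c : Cell) (a b : L) (ha : a ∈ dir c) (hb : b ∈ dir c) (ε δ : Bool)
    (hb' : b ∈ dir (face c a ha ε)) (ha' : a ∈ dir (face c b hb δ)),
    face (face c a ha ε) b hb' δ = face (face c b hb δ) a ha' ε

namespace LabelledCubeComplex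

variable {L : Type u} [DecidableEq L] (X : LabelledCubeComplex.{u, v} L)

/-- The edges of a cube complex, with their labels. -/
structure Edge where
  cell : X.Cell
  label : L
  dir_cell : X.dir cell = {label}

namespace Edge

variable {X}

/-- The initial vertex (`ε = false`) or terminal vertex (`ε = true`) of an edge. -/
def endpoint (e : X.Edge) (ε : Bool) : X.Cell :=
  X.face e.cell e.label (by rw [e.dir_cell]; exact Finset.mem_singleton_self _) ε

/-- `e` and `f` are opposite edges of some square of the complex. -/
def Opposite (e f : X.Edge) : Prop :=
  ∃ (c : X.Cell) (a b : L) (hb : b ∈ X.dir c), a ≠ b ∧ X.dir c = {a, b} ∧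
    e.cell = X.face c b hb false ∧ f.cell = X.face c b hb true

end Edge

/-- The hyperplanes of a cube complex: they are the classes of edges for the equivalence relation
generated by being opposite edges of a square. -/
def Hyperplane : Type (max u v) := Quot (Edge.Opposite (X := X))

variable {X} in
/-- The edge `e` is dual to the hyperplane `H`. -/
def Edge.IsDualTo (e : X.Edge) (H : X.Hyperplane) : Prop :=
  Quot.mk Edge.Opposite e = H

/-- The cells `x` and `y` are vertices joined by an edge path, each edge of which (traversed in
either direction) has its label in `S`. -/
def JoinedByPathLabelledIn (S : Set L) (x y : X.Cell) : Prop :=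
  X.dir x = ∅ ∧ X.dir y = ∅ ∧
    Relation.ReflTransGen (fun p q : X.Cell => ∃ (e : X.Edge) (ε : Bool),
      e.label ∈ S ∧ e.endpoint ε = p ∧ e.endpoint (!ε) = q) x y

/-- The unit cube with coordinates in `A`, as the subspace of `ℝ^L` in which the coordinates in
`A` lie in `[0,1]` and the others vanish. It carries the Euclidean metric. -/
abbrev Cube [Fintype L] (A : Finset L) : Type u :=
  {t : EuclideanSpace ℝ L // (∀ a ∈ A, t a ∈ Set.Icc (0 : ℝ) 1) ∧ ∀ a ∉ A, t a = 0}

/-- The inclusion of the unit cube with coordinates in `A \ {a}` as the face of the unit cube with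
coordinates in `A` on which the coordinate `a` is `0`, resp. `1`. -/
noncomputable def Cube.incl [Fintype L] {A B : Finset L} (a : L) (ha : a ∈ A) (hB : B = A.erase a)
    (ε : Bool) (t : Cube B) : Cube A :=
  ⟨WithLp.toLp 2 (Function.update (fun b => t.1 b) a (if ε then 1 else 0)), by
    subst hB
    refine ⟨fun b hb => ?_, fun b hb => ?_⟩
    · by_cases h : b = a
      · subst h
        cases ε <;> simp
      · simpa [Function.update_of_ne h] using t.2.1 b (Finset.mem_erase.2 ⟨h, hb⟩)
    · have h : b ≠ a := fun h => hb (h ▸ ha)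
      simpa [Function.update_of_ne h] using t.2.2 b (fun h' => hb (Finset.mem_of_mem_erase h'))⟩

section Realization

variable [Fintype L]

/-- The gluing relation: the unit cube of a face of `c` is identified with the corresponding
face of the unit cube of `c`. -/
inductive Glue : (Σ c : X.Cell, Cube (X.dir c)) → (Σ c : X.Cell, Cube (X.dir c)) → Prop
  | face (c : X.Cell) (a : L) (ha : a ∈ X.dir c) (ε : Bool) (t : Cube (X.dir (X.face c a ha ε))) :
    Glue ⟨X.face c a ha ε, t⟩ ⟨c, Cube.incl a ha (X.dir_face c a ha ε) ε t⟩

/-- The geometric realization of a cube complex: one unit cube for each cell, glued along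
faces. -/
def Realization : Type (max u v) := Quot X.Glue

/-- The characteristic map of the cell `c`. -/
def charMap (c : X.Cell) (t : Cube (X.dir c)) : X.Realization := Quot.mk _ ⟨c, t⟩

/-- `IsStringLength x y l` says that `l` is the length of a string from `x` to `y`, i.e. of a finite
sequence of points, any two consecutive ones of which lie in a common cube; its length is
the sum of the Euclidean distances, in these cubes, between consecutive points. -/
inductive IsStringLength : X.Realization → X.Realization → ENNReal → Prop
  | nil (x : X.Realization) : IsStringLength x x 0
  | cons (c : X.Cell) (s t : Cube (X.dir c)) (y : X.Realization) (l : ENNReal) :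
    IsStringLength (X.charMap c t) y l → IsStringLength (X.charMap c s) y (edist s t + l)

variable {X}

theorem IsStringLength.append {x y z : X.Realization} {l m : ENNReal}
    (h : X.IsStringLength x y l) (h' : X.IsStringLength y z m) : X.IsStringLength x z (l + m) := by
  induction h with
  | nil => simpa using h'
  | cons c s t y l _ ih => rw [add_assoc]; exact .cons c s t _ _ (ih h')

theorem IsStringLength.symm {x y : X.Realization} {l : ENNReal}
    (h : X.IsStringLength x y l) : X.IsStringLength y x l := by
  induction h with
  | nil => exact .nil _
  | cons c s t y l _ ih =>
    have h1 := IsStringLength.cons c t s _ _ (.nil (X.charMap c s))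
    have h2 := ih.append h1
    rwa [add_zero, add_comm, edist_comm] at h2

/-- The length metric of the geometric realization: the distance of two points is the infimum
of the lengths of the strings joining them (and `∞` if there are none). -/
noncomputable instance : PseudoEMetricSpace X.Realization where
  edist x y := sInf {l | X.IsStringLength x y l}
  edist_self x := le_antisymm (sInf_le (.nil x)) bot_le
  edist_comm x y := by
    congr 1
    ext l
    exact ⟨IsStringLength.symm, IsStringLength.symm⟩
  edist_triangle x y z := by
    rw [ENNReal.sInf_add]
    refine le_iInf₂ fun l hl => ?_
    rw [add_comm, ENNReal.sInf_add]
    refine le_iInf₂ fun m hm => ?_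
    rw [add_comm]
    exact sInf_le (IsStringLength.append hl hm)

end Realization

end LabelledCubeComplex

/-! ## Whitehead partitions -/

section Whitehead

variable {V : Type u} (Γ : SimpleGraph V)

/-- `lk(v) ⊆ st(w)`. -/
def VertexLE (v w : V) : Prop := Γ.neighborSet v ⊆ insert w (Γ.neighborSet w)

/-- The equivalence `v ∼ w` of vertices. -/
def VertexEquiv (v w : V) : Prop := VertexLE Γ v w ∧ VertexLE Γ w v

/-- `v` and `w` are vertices of `Γ ∖ st(m)` in the same connected component. -/
def SameComponentAwayFromStar (m v w : V) : Prop :=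
  ∃ (hv : v ∈ (insert m (Γ.neighborSet m))ᶜ) (hw : w ∈ (insert m (Γ.neighborSet m))ᶜ),
    (Γ.induce (insert m (Γ.neighborSet m))ᶜ).Reachable ⟨v, hv⟩ ⟨w, hw⟩

/-- `(P, m)` is a `Γ`-Whitehead pair. The symmetric set `V^±` is `V × Bool`, where `(v, true)` is
`v` and `(v, false)` is `v⁻¹`. -/
structure IsWhiteheadPair (P : Set (V × Bool)) (m : V × Bool) : Prop where
  nontrivial : P.Nontrivial
  mem : m ∈ P
  inv_notMem : (m.1, !m.2) ∉ P
  not_adj : ∀ x ∈ P, ¬ Γ.Adj x.1 m.1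
  le_of_single : ∀ x ∈ P, (x.1, !x.2) ∉ P → VertexLE Γ x.1 m.1
  component : ∀ v w : V, (v, true) ∈ P → (v, false) ∈ P → SameComponentAwayFromStar Γ m.1 v w →
    (w, true) ∈ P ∧ (w, false) ∈ P

/-- A `Γ`-Whitehead partition `{P, lk(P), P*}`, presented by one of its sides, `P`. -/
structure WhiteheadPartition where
  P : Set (V × Bool)
  exists_pair : ∃ m, IsWhiteheadPair Γ P m

namespace WhiteheadPartition

variable {Γ} (p q : WhiteheadPartition Γ)

/-- The link of the partition, as a set of vertices of `Γ`: it is `lk(m)` for every `m` such that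
`(P, m)` is a Whitehead pair (see `lk_eq`). -/
def lk : Set V := {v | ∃ m, IsWhiteheadPair Γ p.P m ∧ Γ.Adj m.1 v}

/-- The two sides of the partition: `side false` is `P`, and `side true` is the complement `P*` of
`P ∪ lk(P)` in `V^±`. -/
def side : Bool → Set (V × Bool)
  | false => p.P
  | true => {x | x ∉ p.P ∧ x.1 ∉ p.lk}

/-- The partition `{P, lk(P), P*}` itself. -/
def blocks : Set (Set (V × Bool)) := {p.side false, {x | x.1 ∈ p.lk}, p.side true}

/-- The vertices `v` such that `v` and `v⁻¹` are in different sides of the partition. -/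
def single : Set V := {v | ∃ b, (v, true) ∈ p.side b ∧ (v, false) ∈ p.side (!b)}

/-- The vertices `v` such that `v` or `v⁻¹` is in `max(P)`, the set of the `x ∈ P` with
`x⁻¹ ∉ P` and `x ∼ m`, where `(P, m)` is a Whitehead pair. -/
def max : Set V := {v | ∃ m, IsWhiteheadPair Γ p.P m ∧
  ∃ s, (v, s) ∈ p.P ∧ (v, !s) ∉ p.P ∧ VertexEquiv Γ v m.1}

/-- Two partitions commute if their maximal elements are distinct commuting generators, i.e. are
adjacent in `Γ`. -/
def Commutes : Prop := ∀ v ∈ p.max, ∀ w ∈ q.max, Γ.Adj v w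

/-- Two partitions are compatible if they commute or some side of the one is disjoint from some
side of the other. -/
def Compatible : Prop := p.Commutes q ∨ ∃ a b : Bool, p.side a ∩ q.side b = ∅

end WhiteheadPartition

end Whitehead

/-- `W` enumerates without repetition a set of `k` pairwise compatible partitions. -/
structure IsCompatibleSet {V : Type u} {Γ : SimpleGraph V} {k : ℕ}
    (W : Fin k → WhiteheadPartition Γ) : Prop where
  blocks_ne : ∀ i j, i ≠ j → (W i).blocks ≠ (W j).blocks
  compatible : ∀ i j, i ≠ j → (W i).Compatible (W j)

namespace WhiteheadPartition

section Regions

variable {V : Type u} {Γ : SimpleGraph V} {k : ℕ} (W : Fin k → WhiteheadPartition Γ)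

/-- The choice of the side `(W i).side (R i)` for each `i` is a region. -/
def IsRegion (R : Fin k → Bool) : Prop :=
  ∀ i j, i ≠ j → (W i).Commutes (W j) ∨ ((W i).side (R i) ∩ (W j).side (R j)).Nonempty

/-- The set `I(R)`: the elements of `V^±` which for each `i` lie in the chosen side or in the
link of the `i`-th partition. -/
def inside (R : Fin k → Bool) : Set (V × Bool) :=
  {x | ∀ i, x ∈ (W i).side (R i) ∨ x.1 ∈ (W i).lk}

/-- Traversing an edge with the label `l` switches the side of the `i`-th partition. Here the
label `Sum.inl v` stands for `e_v`, and `Sum.inr i` for the label of the `i`-th partition. -/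
def Switches : V ⊕ Fin k → Fin k → Prop
  | Sum.inl v, i => v ∈ (W i).single
  | Sum.inr j, i => i = j

open Classical in
/-- The choice of sides at the other end of an edge with the label `l`. -/
noncomputable def switch (l : V ⊕ Fin k) (R : Fin k → Bool) : Fin k → Bool :=
  fun i => if Switches W l i then !(R i) else R i

/-- An edge with the given label starts at the vertex `x_R`. The edge `e_v` is directed from the
region containing `v⁻¹` to the one containing `v`. The edge of the `i`-th partition is directed
from `P_i` to `P_i*`; it is present if switching the side of this partition
gives a region. -/
def Starts (R : Fin k → Bool) : V ⊕ Fin k → Prop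
  | Sum.inl v => (v, false) ∈ inside W R
  | Sum.inr i => R i = false ∧ IsRegion W (switch W (Sum.inr i) R)

/-- Commuting labels. -/
def CommutingLabels : V ⊕ Fin k → V ⊕ Fin k → Prop
  | Sum.inl v, Sum.inl w => Γ.Adj v w
  | Sum.inl v, Sum.inr i => v ∈ (W i).lk
  | Sum.inr i, Sum.inl v => v ∈ (W i).lk
  | Sum.inr i, Sum.inr j => i ≠ j ∧ (W i).Commutes (W j)

/-- The cubes of the blowup: there is one for each vertex `x_R` and each set of edges starting at
`x_R` with pairwise commuting labels, `x_R` being the vertex of the cube at which all its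
edges start. -/
structure BlowupCell where
  region : Fin k → Bool
  labels : Finset (V ⊕ Fin k)
  isRegion : IsRegion W region
  starts : ∀ a ∈ labels, Starts W region a
  commuting : ∀ a ∈ labels, ∀ b ∈ labels, a ≠ b → CommutingLabels W a b

end Regions

/-! ### The faces of a cube are cubes -/

section Facts

variable {V : Type u} {Γ : SimpleGraph V}

theorem lk_eq (p : WhiteheadPartition Γ) {m : V × Bool} (h : IsWhiteheadPair Γ p.P m) :
    p.lk = Γ.neighborSet m.1 := by
  ext v
  constructor
  · rintro ⟨m', h', hv⟩
    have h1 : VertexLE Γ m'.1 m.1 := h.le_of_single _ h'.mem h'.inv_notMem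
    rcases h1 hv with h2 | h2
    · subst h2
      exact absurd hv.symm (h'.not_adj _ h.mem)
    · exact h2
  · intro hv
    exact ⟨m, h, hv⟩

theorem notMem_lk_of_mem_side (p : WhiteheadPartition Γ) {b : Bool} {x : V × Bool}
    (hx : x ∈ p.side b) : x.1 ∉ p.lk := by
  cases b
  · rintro ⟨m, hm, h⟩
    exact hm.not_adj x hx h.symm
  · exact hx.2

theorem mem_side_or (p : WhiteheadPartition Γ) {x : V × Bool} (hx : x.1 ∉ p.lk) (b : Bool) :
    x ∈ p.side b ∨ x ∈ p.side (!b) := by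
  by_cases h : x ∈ p.P
  · cases b
    · exact Or.inl h
    · exact Or.inr h
  · cases b
    · exact Or.inr ⟨h, hx⟩
    · exact Or.inl ⟨h, hx⟩

theorem notMem_side_not (p : WhiteheadPartition Γ) {x : V × Bool} {b : Bool}
    (hx : x ∈ p.side b) : x ∉ p.side (!b) := by
  cases b
  · exact fun h => h.1 hx
  · exact fun h => hx.1 h

theorem inv_mem_side_of_single (p : WhiteheadPartition Γ) {v : V} (hv : v ∈ p.single)
    {s b : Bool} (h : (v, s) ∈ p.side b) : (v, !s) ∈ p.side (!b) := by
  obtain ⟨c, h1, h2⟩ := hv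
  by_cases hbc : b = c
  · subst hbc
    cases s
    · exact absurd h2 (p.notMem_side_not h)
    · exact h2
  · obtain rfl : c = !b := by cases b <;> cases c <;> simp_all
    cases s
    · exact h1
    · exact absurd h1 (p.notMem_side_not h)

theorem notMem_lk_of_single (p : WhiteheadPartition Γ) {v : V} (hv : v ∈ p.single) :
    v ∉ p.lk := by
  obtain ⟨c, h1, _⟩ := hv
  exact p.notMem_lk_of_mem_side h1

theorem inv_mem_side_of_not_single (p : WhiteheadPartition Γ) {v : V} (hv : v ∉ p.single)
    {b : Bool} (h : (v, false) ∈ p.side b) : (v, true) ∈ p.side b := by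
  rcases p.mem_side_or (x := (v, true)) (p.notMem_lk_of_mem_side h :) b with h1 | h1
  · exact h1
  · exact absurd ⟨!b, h1, by simpa using h⟩ hv

theorem mem_lk_of_adj_single (p : WhiteheadPartition Γ) {v w : V} (hv : v ∈ p.single)
    (h : Γ.Adj v w) : w ∈ p.lk := by
  obtain ⟨m, hm⟩ := p.exists_pair
  have key : ∃ s, (v, s) ∈ p.P ∧ (v, !s) ∉ p.P := by
    obtain ⟨c, h1, h2⟩ := hv
    cases c
    · exact ⟨true, h1, h2.1⟩
    · exact ⟨false, h2, h1.1⟩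
  obtain ⟨s, h1, h2⟩ := key
  rw [p.lk_eq hm]
  rcases hm.le_of_single _ h1 h2 h with h3 | h3
  · subst h3
    exact absurd h (hm.not_adj _ h1)
  · exact h3

theorem commutes_of_single_of_mem_lk (p q : WhiteheadPartition Γ) {v : V} (hv : v ∈ p.single)
    (hv' : v ∈ q.lk) : p.Commutes q := by
  rintro x ⟨m, hm, s, hx, -, hxm⟩ y ⟨n, hn, t, hy, -, hyn⟩
  rw [q.lk_eq hn] at hv'
  have h1 : n.1 ∈ p.lk := p.mem_lk_of_adj_single hv (SimpleGraph.Adj.symm hv')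
  have h1' : n.1 ∈ Γ.neighborSet m.1 := by rwa [p.lk_eq hm] at h1
  have h2 : Γ.Adj x n.1 := by
    rcases hxm.2 h1' with h3 | h3
    · exact absurd (h3 ▸ h1) (p.notMem_lk_of_mem_side (b := false) hx)
    · exact h3
  rcases hyn.2 h2.symm with h3 | h3
  · exact absurd (h3 ▸ h2) (hn.not_adj _ hy)
  · exact SimpleGraph.Adj.symm h3

theorem Commutes.symm {p q : WhiteheadPartition Γ} (h : p.Commutes q) : q.Commutes p :=
  fun v hv w hw => (h w hw v hv).symm

variable {k : ℕ} {W : Fin k → WhiteheadPartition Γ}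

theorem switch_switch (a b : V ⊕ Fin k) (R : Fin k → Bool) :
    switch W a (switch W b R) = switch W b (switch W a R) := by
  funext i
  simp only [switch]
  split_ifs <;> rfl

theorem isRegion_switch_inl {R : Fin k → Bool} (hR : IsRegion W R) {v : V}
    (hv : (v, false) ∈ inside W R) : IsRegion W (switch W (Sum.inl v) R) := by
  have aux : ∀ i, v ∉ (W i).lk → (v, true) ∈ (W i).side (switch W (Sum.inl v) R i) := by
    intro i hi
    have h1 : (v, false) ∈ (W i).side (R i) := (hv i).resolve_right hi
    by_cases hs : v ∈ (W i).single
    · simpa [switch, Switches, hs] using (W i).inv_mem_side_of_single hs h1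
    · simpa [switch, Switches, hs] using (W i).inv_mem_side_of_not_single hs h1
  intro i j hij
  by_cases hi : v ∈ (W i).lk
  · by_cases hj : v ∈ (W j).single
    · exact Or.inl (commutes_of_single_of_mem_lk _ _ hj hi).symm
    · have h1 : v ∉ (W i).single := fun h => (W i).notMem_lk_of_single h hi
      simpa [switch, Switches, hj, h1] using hR i j hij
  · by_cases hj : v ∈ (W j).lk
    · by_cases hi' : v ∈ (W i).single
      · exact Or.inl (commutes_of_single_of_mem_lk _ _ hi' hj)
      · have h1 : v ∉ (W j).single := fun h => (W j).notMem_lk_of_single h hj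
        simpa [switch, Switches, hi', h1] using hR i j hij
    · exact Or.inr ⟨(v, true), aux i hi, aux j hj⟩

theorem isRegion_switch {R : Fin k → Bool} (hR : IsRegion W R) {a : V ⊕ Fin k}
    (ha : Starts W R a) : IsRegion W (switch W a R) := by
  cases a with
  | inl v => exact isRegion_switch_inl hR ha
  | inr i => exact ha.2

theorem starts_switch {R : Fin k → Bool} {a b : V ⊕ Fin k}
    (ha : Starts W R a) (hb : Starts W R b) (hab : CommutingLabels W a b) :
    Starts W (switch W a R) b := by
  have inl_inr : ∀ (v : V) (i : Fin k), v ∈ (W i).lk → (v, false) ∈ inside W R →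
      (v, false) ∈ inside W (switch W (Sum.inr i) R) := by
    intro v i h hv j
    by_cases hj : j = i
    · subst hj
      exact Or.inr h
    · simpa [switch, Switches, hj] using hv j
  cases a with
  | inl v =>
    cases b with
    | inl w =>
      intro i
      by_cases hs : v ∈ (W i).single
      · exact Or.inr ((W i).mem_lk_of_adj_single hs hab)
      · simpa [switch, Switches, hs] using hb i
    | inr i =>
      have hs : v ∉ (W i).single := fun h => (W i).notMem_lk_of_single h hab
      refine ⟨by simpa [switch, Switches, hs] using hb.1, ?_⟩
      rw [switch_switch]
      exact isRegion_switch_inl hb.2 (inl_inr v i hab ha)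
  | inr i =>
    cases b with
    | inl w => exact inl_inr w i hab hb
    | inr j =>
      have hij : i ≠ j := hab.1
      have hc : (W i).Commutes (W j) := hab.2
      refine ⟨by simpa [switch, Switches, hij.symm] using hb.1, ?_⟩
      intro r s hrs
      by_cases h1 : r = j
      · subst h1
        by_cases h2 : s = i
        · subst h2
          exact Or.inl hc.symm
        · simpa [switch, Switches, h2, hrs, hrs.symm, hij, hij.symm] using hb.2 r s hrs
      · by_cases h2 : s = j
        · subst h2
          by_cases h3 : r = i
          · subst h3
            exact Or.inl hc
          · simpa [switch, Switches, h1, h3, hrs, hij, hij.symm] using hb.2 r s hrs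
        · simpa [switch, Switches, h1, h2] using ha.2 r s hrs

end Facts

section Blowup

variable {V : Type u} [DecidableEq V] {Γ : SimpleGraph V} {k : ℕ}
  (W : Fin k → WhiteheadPartition Γ)

variable {W} in
/-- The face of the cube `c` at the start (`ε = false`) or at the end (`ε = true`) of its edges
with the label `a`. -/
noncomputable def BlowupCell.face (c : BlowupCell W) (a : V ⊕ Fin k) (ha : a ∈ c.labels)
    (ε : Bool) : BlowupCell W where
  region := if ε then switch W a c.region else c.region
  labels := c.labels.erase a
  isRegion := by
    cases ε
    · exact c.isRegion
    · exact isRegion_switch c.isRegion (c.starts a ha)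
  starts b hb := by
    have hb' := Finset.mem_erase.1 hb
    cases ε
    · exact c.starts b hb'.2
    · exact starts_switch (c.starts a ha) (c.starts b hb'.2)
        (c.commuting a ha b hb'.2 hb'.1.symm)
  commuting b hb d hd h :=
    c.commuting b (Finset.mem_of_mem_erase hb) d (Finset.mem_of_mem_erase hd) h

theorem BlowupCell.face_face (c : BlowupCell W) (a b : V ⊕ Fin k) (ha : a ∈ c.labels)
    (hb : b ∈ c.labels) (ε δ : Bool) (hb' : b ∈ (c.face a ha ε).labels)
    (ha' : a ∈ (c.face b hb δ).labels) :
    (c.face a ha ε).face b hb' δ = (c.face b hb δ).face a ha' ε := by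
  simp only [BlowupCell.face, BlowupCell.mk.injEq]
  refine ⟨?_, Finset.erase_right_comm⟩
  cases ε <;> cases δ <;> simp [switch_switch]

/-- The blowup of the Salvetti complex of `Γ` with respect to the partitions `W i`. -/
noncomputable def blowup : LabelledCubeComplex.{u, u} (V ⊕ Fin k) where
  Cell := BlowupCell W
  dir c := c.labels
  face := BlowupCell.face
  dir_face _ _ _ _ := rfl
  face_face := BlowupCell.face_face W

/-- The vertex `x_R` of the blowup. -/
def blowupVertex (R : Fin k → Bool) (hR : IsRegion W R) : (blowup W).Cell :=
  { region := R
    labels := ∅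
    isRegion := hR
    starts := by simp
    commuting := by simp }

end Blowup

end WhiteheadPartition

/-! Local CAT(0)-ness is an instance of Gromov's link condition. Edges at a vertex with pairwise
commuting labels always span a cube, so near `x_R` the blowup looks like an orthant space: one
Euclidean orthant for each clique of half-edges at `x_R`. An orthant space is CAT(0) by induction on
the number of coordinates (`isStewart_supportedOn`): for a coordinate `h`, it is the union of the
part where `h` vanishes and of the product of the link of `h` with a half-line, glued along the
link, and Reshetnyak's theorem (`IsStewart.glue`) applies. CAT(0)-ness is handled through Stewart's
inequality for intermediate points, which yields existence and uniqueness of geodesics and the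
comparison of triangles (`isCAT0_of_isometry`). Strings in the blowup lift to the chart at a vertex
and chains in the chart push down, so a ball of radius 1/8 about any point is isometric to a ball in
an orthant space, centred at a point that need not be the apex (`isLocallyCAT0_blowup`).

The rest is combinatorics of regions. Among the partitions on which `R` and `R'` differ, one whose
side in `R` is smallest can be switched (`exists_isRegion_switch`); iterating gives the edge paths.
If edges with label `a` start at two regions, then `a` commutes with every partition on which the
regions differ (`commutingLabels_of_starts`), so every step of such a path sweeps out a square, and
the two edges are dual to the same hyperplane. Connectedness follows, since cubes are connected and
a region exists (`exists_isRegion`). -/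

/-! ## Stewart's inequality and Reshetnyak gluing -/

section Stewart

variable {Z : Type u} [MetricSpace Z]

/-- Stewart's inequality: seen from `p`, the point `z` is at most as far as the point that divides
the side `[x, y]` of a Euclidean comparison triangle in the ratio `t : 1 - t`. -/
def StewartLE (x y : Z) (t : ℝ) (z p : Z) : Prop :=
  dist p z ^ 2 ≤ (1 - t) * dist p x ^ 2 + t * dist p y ^ 2 - t * (1 - t) * dist x y ^ 2

/-- A subset of a metric space which is a CAT(0) space for the induced metric: any two of its
points have intermediate points satisfying Stewart's inequality. -/
def IsStewart (S : Set Z) : Prop :=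
  ∀ x ∈ S, ∀ y ∈ S, ∀ t ∈ Set.Icc (0 : ℝ) 1, ∃ z ∈ S, ∀ p ∈ S, StewartLE x y t z p

theorem StewartLE.symm {x y z p : Z} {t : ℝ} (h : StewartLE x y t z p) :
    StewartLE y x (1 - t) z p := by
  unfold StewartLE at *
  rw [dist_comm y x]
  linarith

/-- The distances from an intermediate point to the ends of a segment. -/
theorem dist_left_of_stewartLE {x y z : Z} {t : ℝ} (ht : t ∈ Set.Icc (0 : ℝ) 1)
    (h : StewartLE x y t z x) : dist x z ≤ t * dist x y := by
  unfold StewartLE at h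
  rw [dist_self] at h
  refine abs_le_of_sq_le_sq' ?_ (mul_nonneg ht.1 dist_nonneg) |>.2
  nlinarith

/-- By the law of cosines, the right-hand side is the squared distance of the comparison points in
the plane. The bound comes from Stewart for `[a, c]` seen from `e`, whose distances to `a` and `c`
are in turn bounded by Stewart for `[a, d]`. -/
theorem two_point_of_stewartLE {a d c e f : Z} {s t : ℝ} (hs : s ∈ Set.Icc (0 : ℝ) 1)
    (ht : t ∈ Set.Icc (0 : ℝ) 1)
    (h1 : StewartLE a d s e a) (h2 : StewartLE a d s e c) (h3 : StewartLE a c t f e) :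
    dist e f ^ 2 ≤ s ^ 2 * dist a d ^ 2 + t ^ 2 * dist a c ^ 2 -
      s * t * (dist a d ^ 2 + dist a c ^ 2 - dist d c ^ 2) := by
  have h4 : dist a e ^ 2 ≤ (s * dist a d) ^ 2 :=
    pow_le_pow_left₀ dist_nonneg (dist_left_of_stewartLE hs h1) 2
  unfold StewartLE at *
  rw [dist_comm e a] at h3
  rw [dist_comm c e, dist_comm c a, dist_comm c d] at h2
  have h5 := mul_le_mul_of_nonneg_left h2 ht.1
  have h6 := mul_le_mul_of_nonneg_left h4 (sub_nonneg.2 ht.2)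
  linarith

/-- Cauchy–Schwarz in the form `(u + v)² ≤ (p + q)(u²/p + v²/q)`, with denominators cleared. The
hypotheses `hg` and `hf` take its place when `q = 0`. -/
theorem add_sq_le_of_sq_le {u v f g S p q : ℝ} (hp : 0 < p) (hq : 0 ≤ q)
    (hu : u ^ 2 ≤ f) (hv : v ^ 2 ≤ g) (hg : q = 0 → g ≤ 0)
    (hS : (p + q) * (q * f + p * g) ≤ p * q * S) (hf : q = 0 → f ≤ S) :
    (u + v) ^ 2 ≤ S := by
  rcases hq.eq_or_lt with hq0 | hq0
  · have h1 := hg hq0.symm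
    have h2 := hf hq0.symm
    have : v = 0 := by nlinarith
    subst this
    simpa using hu.trans h2
  · have h1 : p * q * (u + v) ^ 2 ≤ p * q * S := by
      refine le_trans ?_ hS
      have h2 : (p + q) * (q * u ^ 2 + p * v ^ 2) ≤ (p + q) * (q * f + p * g) := by gcongr
      nlinarith [sq_nonneg (q * u - p * v)]
    exact le_of_mul_le_mul_left h1 (by positivity)

/-- If `d` lies between `b` and `c`, then Stewart's inequality for the segment `[a, d]`, seen
from `b`, and the comparison inequality for the triangle `a, d, c` give Stewart's inequality
for the segment `[a, c]`, seen from `b`. -/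
theorem stewartLE_of_between {a b c d f : Z} {t : ℝ} (ht : t ∈ Set.Icc (0 : ℝ) 1)
    (hd : dist b c = dist b d + dist d c)
    (h : ∀ s ∈ Set.Icc (0 : ℝ) 1, ∃ e, StewartLE a d s e b ∧
      dist e f ^ 2 ≤ s ^ 2 * dist a d ^ 2 + t ^ 2 * dist a c ^ 2 -
        s * t * (dist a d ^ 2 + dist a c ^ 2 - dist d c ^ 2)) :
    StewartLE a c t f b := by
  obtain ⟨ht0, ht1⟩ := ht
  unfold StewartLE at *
  rcases (dist_nonneg (x := b) (y := d)).eq_or_lt with hp | hp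
  · obtain ⟨e, h1, h2⟩ := h 1 ⟨zero_le_one, le_rfl⟩
    rw [← hp] at h1
    have hbd : b = d := dist_eq_zero.1 hp.symm
    have hbe : b = e := dist_eq_zero.1 (by nlinarith [dist_nonneg (x := b) (y := e)])
    subst hbd
    subst hbe
    rw [dist_comm a b] at h2
    linarith
  · set p := dist b d
    set q := dist d c
    have hq : 0 ≤ q := dist_nonneg
    have hw : 0 < p + t * q := by positivity
    -- In a Euclidean triangle `a, b, c` with `d` on `[b, c]`, the segment from `b` to the point of
    -- `[a, c]` with parameter `t` meets `[a, d]` at this parameter.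
    have hs1 : t * (p + q) / (p + t * q) ≤ 1 := by
      rw [div_le_one hw]
      nlinarith
    obtain ⟨e, h1, h2⟩ := h (t * (p + q) / (p + t * q)) ⟨by positivity, hs1⟩
    set s := t * (p + q) / (p + t * q) with hs
    have hsw : s * (p + t * q) = t * (p + q) := by
      rw [hs]
      field_simp
    set x := dist a d
    set y := dist a c
    set z := dist b a
    have htri : dist b f ≤ dist b e + dist e f := dist_triangle _ _ _
    refine (pow_le_pow_left₀ dist_nonneg htri 2).trans ?_
    rw [hd]
    -- In the Euclidean picture `e` divides the segment from `b` to `f` in the ratio `p : t * q`, so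
    -- with these weights Cauchy–Schwarz loses nothing.
    refine add_sq_le_of_sq_le hp (mul_nonneg ht0 hq) h1 h2 ?_ ?_ ?_
    · intro h0
      rcases mul_eq_zero.1 h0 with h0 | h0
      · have : s = 0 := by rw [hs, h0]; simp
        rw [this, h0]
        simp
      · have : s = t := by rw [hs, h0]; field_simp; ring
        have hxy : x = y := by
          have : d = c := dist_eq_zero.1 h0
          simp only [x, y, this]
        rw [this, h0, hxy]
        apply le_of_eq
        ring
    · have e1 : s = t * (p + q) / (p + t * q) := hs
      rw [e1]
      apply le_of_eq
      field_simp
      ring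
    · intro h0
      rcases mul_eq_zero.1 h0 with h0 | h0
      · have : s = 0 := by rw [hs, h0]; simp
        rw [this, h0]
        simp
      · have : s = t := by rw [hs, h0]; field_simp; ring
        have hxy : x = y := by
          have : d = c := dist_eq_zero.1 h0
          simp only [x, y, this]
        rw [this, h0, hxy]
        apply le_of_eq
        ring

/-- Inserting the two bounds into Stewart's inequality seen from `w` makes its right-hand side at
most zero. Intermediate points are therefore unique. -/
theorem eq_of_stewartLE {x y z w : Z} {t : ℝ} (ht : t ∈ Set.Icc (0 : ℝ) 1)
    (hx : dist x w ≤ t * dist x y) (hy : dist y w ≤ (1 - t) * dist x y)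
    (h : StewartLE x y t z w) : w = z := by
  have h1 := pow_le_pow_left₀ dist_nonneg hx 2
  have h2 := pow_le_pow_left₀ dist_nonneg hy 2
  unfold StewartLE at h
  rw [dist_comm w x, dist_comm w y] at h
  have h3 := mul_le_mul_of_nonneg_left h1 (sub_nonneg.2 ht.2)
  have h4 := mul_le_mul_of_nonneg_left h2 ht.1
  have h5 : dist w z ^ 2 ≤ 0 := by nlinarith
  exact dist_eq_zero.1 (by nlinarith [dist_nonneg (x := w) (y := z)])

theorem dist_right_of_stewartLE {x y z : Z} {t : ℝ} (ht : t ∈ Set.Icc (0 : ℝ) 1)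
    (h : StewartLE x y t z y) : dist y z ≤ (1 - t) * dist x y := by
  rw [dist_comm x y]
  exact dist_left_of_stewartLE ⟨by linarith [ht.2], by linarith [ht.1]⟩ h.symm

/-- Intermediate points do not depend on the ambient Stewart subset. -/
theorem stewartLE_of_subset {A X : Set Z} (hX : IsStewart X) (hAX : A ⊆ X) {x y z : Z} {t : ℝ}
    (ht : t ∈ Set.Icc (0 : ℝ) 1) (hx : x ∈ A) (hy : y ∈ A)
    (hz : ∀ p ∈ A, StewartLE x y t z p) {p : Z} (hp : p ∈ X) (hzA : z ∈ X) :
    StewartLE x y t z p := by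
  obtain ⟨w, hw, hw'⟩ := hX x (hAX hx) y (hAX hy) t ht
  have : z = w := eq_of_stewartLE ht (dist_left_of_stewartLE ht (hz x hx))
    (dist_right_of_stewartLE ht (hz y hy)) (hw' z hzA)
  exact this ▸ hw' p hp

/-- Stewart's inequality for a segment on one side of the gluing locus, seen from the other
side. -/
theorem stewartLE_across {X₁ X₂ A : Set Z} (h₁ : IsStewart X₁) (hA : IsStewart A)
    (h₂ : IsStewart X₂) (hA₁ : A ⊆ X₁) (hA₂ : A ⊆ X₂)
    (hcross : ∀ x ∈ X₁, ∀ p ∈ X₂, ∃ a ∈ A, dist p x = dist p a + dist a x)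
    {x y z p : Z} {t : ℝ} (hx : x ∈ X₁) (hy : y ∈ X₁) (ht : t ∈ Set.Icc (0 : ℝ) 1)
    (hz : ∀ p ∈ X₁, StewartLE x y t z p) (hp : p ∈ X₂) : StewartLE x y t z p := by
  obtain ⟨a, ha, hpa⟩ := hcross x hx p hp
  obtain ⟨b, hb, hpb⟩ := hcross y hy p hp
  -- The geodesics from `p` to `x` and `y` cross `A` at `a` and `b`. The triangle `p, a, b` lies in
  -- `X₂`, while `a, b, y` and `a, y, x` lie in `X₁`; they are stacked by `stewartLE_of_between`,
  -- first along `[a, b]` and then along `[a, y]`.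
  have step : ∀ s ∈ Set.Icc (0 : ℝ) 1, ∀ e, (∀ q ∈ X₁, StewartLE a y s e q) →
      StewartLE a y s e p := by
    intro s hs e he
    refine stewartLE_of_between hs hpb fun r hr => ?_
    obtain ⟨g, hg, hg'⟩ := hA a ha b hb r hr
    refine ⟨g, stewartLE_of_subset h₂ hA₂ hr ha hb hg' hp (hA₂ hg), ?_⟩
    exact two_point_of_stewartLE hr hs (hg' a ha)
      (stewartLE_of_subset h₁ hA₁ hr ha hb hg' hy (hA₁ hg)) (he g (hA₁ hg))
  have ht' : 1 - t ∈ Set.Icc (0 : ℝ) 1 := ⟨by linarith [ht.2], by linarith [ht.1]⟩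
  suffices StewartLE y x (1 - t) z p by simpa using this.symm
  refine stewartLE_of_between ht' hpa fun r hr => ?_
  have hr' : 1 - r ∈ Set.Icc (0 : ℝ) 1 := ⟨by linarith [hr.2], by linarith [hr.1]⟩
  obtain ⟨g, hg, hg'⟩ := h₁ a (hA₁ ha) y hy (1 - r) hr'
  have hsymm : ∀ q, StewartLE a y (1 - r) g q → StewartLE y a r g q := fun q h => by
    simpa using h.symm
  exact ⟨g, hsymm _ (step _ hr' g hg'), two_point_of_stewartLE hr ht' (hsymm _ (hg' _ hy))
    (hsymm _ (hg' _ hx)) (hz g hg).symm⟩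

/-- Stewart's inequality at the point where a geodesic crosses the gluing locus. -/
theorem stewart_at_crossing {X₁ X₂ A : Set Z} (h₁ : IsStewart X₁) (hA : IsStewart A)
    (h₂ : IsStewart X₂) (hA₁ : A ⊆ X₁) (hA₂ : A ⊆ X₂)
    (hcross : ∀ x ∈ X₁, ∀ p ∈ X₂, ∃ a ∈ A, dist p x = dist p a + dist a x)
    {x y c p : Z} (hx : x ∈ X₁) (hy : y ∈ X₂) (hc : c ∈ A) (hp : p ∈ X₁)
    (hxy : dist x y = dist x c + dist c y) :
    (dist x c + dist c y) * dist p c ^ 2 ≤ dist c y * dist p x ^ 2 + dist x c * dist p y ^ 2 -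
      dist x c * dist c y * (dist x c + dist c y) := by
  rcases (dist_nonneg (x := x) (y := c)).eq_or_lt with hu | hu
  · rw [← hu, dist_eq_zero.1 hu.symm]
    simp
  rcases (dist_nonneg (x := c) (y := y)).eq_or_lt with hv | hv
  · rw [← hv, dist_eq_zero.1 hv.symm]
    simp
  set u := dist x c
  set v := dist c y
  -- First variation: move `c` a small step `δ` towards `p`, to `w`. The detour through `w` is no
  -- shorter than `[x, y]`, while Stewart for `[c, p]` bounds the distances of `w` from `x` and `y`.
  -- The result is divisible by `δ`, which then tends to zero.
  have key : ∀ δ ∈ Set.Ioo (0 : ℝ) 1, (1 - δ) * ((u + v) * dist p c ^ 2) ≤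
      v * dist p x ^ 2 + u * dist p y ^ 2 - u * v * (u + v) := by
    intro δ hδ
    have hδ' : δ ∈ Set.Icc (0 : ℝ) 1 := ⟨hδ.1.le, hδ.2.le⟩
    obtain ⟨w, hw, hw'⟩ := h₁ c (hA₁ hc) p hp δ hδ'
    have e1 := hw' x hx
    have e2 := stewartLE_across h₁ hA h₂ hA₁ hA₂ hcross (hA₁ hc) hp hδ' hw' hy
    have e3 : u + v ≤ dist x w + dist y w := by
      rw [← hxy, dist_comm y w]
      exact dist_triangle _ _ _
    unfold StewartLE at e1 e2
    rw [dist_comm c p] at e1 e2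
    rw [dist_comm x p] at e1
    rw [dist_comm y p, dist_comm y c] at e2
    -- By Cauchy–Schwarz, among detours of length at least `u + v` this weighted sum is smallest at
    -- `w = c`.
    have e4 : (u + v) * (u * v) ≤ v * dist x w ^ 2 + u * dist y w ^ 2 := by
      have : (u + v) ^ 2 ≤ (dist x w + dist y w) ^ 2 := by gcongr
      have h6 : (u + v) * ((u + v) * (u * v)) ≤
          (u + v) * (v * dist x w ^ 2 + u * dist y w ^ 2) := by
        nlinarith [sq_nonneg (v * dist x w - u * dist y w), mul_pos hu hv]
      exact le_of_mul_le_mul_left h6 (by positivity)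
    have e5 := mul_le_mul_of_nonneg_left e1 hv.le
    have e6 := mul_le_mul_of_nonneg_left e2 hu.le
    have : δ * ((1 - δ) * ((u + v) * dist p c ^ 2)) ≤
      δ * (v * dist p x ^ 2 + u * dist p y ^ 2 - u * v * (u + v)) := by
      change v * dist x w ^ 2 ≤ v * ((1 - δ) * u ^ 2 + δ * dist p x ^ 2 - _) at e5
      change u * dist y w ^ 2 ≤ u * ((1 - δ) * v ^ 2 + δ * dist p y ^ 2 - _) at e6
      nlinarith
    exact le_of_mul_le_mul_left this hδ.1
  have hlim : Filter.Tendsto (fun δ : ℝ => (1 - δ) * ((u + v) * dist p c ^ 2))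
      (nhdsWithin 0 (Set.Ioi 0)) (nhds ((u + v) * dist p c ^ 2)) := by
    have : Continuous (fun δ : ℝ => (1 - δ) * ((u + v) * dist p c ^ 2)) := by fun_prop
    simpa using (this.tendsto 0).mono_left nhdsWithin_le_nhds
  refine le_of_tendsto hlim ?_
  filter_upwards [Ioo_mem_nhdsGT (zero_lt_one (α := ℝ))] with δ hδ using key δ hδ

/-- Stewart at `c` on `[x, y]`, substituted for `dist p c` in Stewart at `z` on `[x, c]`; `hst` says
that the two parameters give the same distance from `x`. -/
theorem stewartLE_of_stewart_at {x y c z p : Z} {s t : ℝ}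
    (hxy : dist x y = dist x c + dist c y) (hpos : 0 < dist x y)
    (hs : s ∈ Set.Icc (0 : ℝ) 1) (hst : t * dist x y = s * dist x c)
    (hc : (dist x c + dist c y) * dist p c ^ 2 ≤ dist c y * dist p x ^ 2 +
      dist x c * dist p y ^ 2 - dist x c * dist c y * (dist x c + dist c y))
    (h : StewartLE x c s z p) : StewartLE x y t z p := by
  unfold StewartLE at *
  rw [hxy] at hpos hst ⊢
  set u := dist x c
  set v := dist c y
  have h1 := mul_le_mul_of_nonneg_left hc hs.1
  have h2 := mul_le_mul_of_nonneg_left h hpos.le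
  refine le_of_mul_le_mul_left (h2.trans ?_) hpos
  have e1 : (u + v) * (t * (1 - t) * (u + v) ^ 2) = s * u * ((u + v) - s * u) * (u + v) := by
    rw [← hst]
    ring
  have e2 : (u + v) * ((1 - t) * dist p x ^ 2 + t * dist p y ^ 2) =
      (u + v - s * u) * dist p x ^ 2 + s * u * dist p y ^ 2 := by
    rw [← hst]
    ring
  rw [mul_sub (u + v) ((1 - t) * _ + _), e1, e2]
  linarith

/-- Treats the part of the segment before the crossing point `c`; the part beyond follows on
exchanging `X₁` with `X₂`. -/
theorem exists_stewartLE_of_crossing {X₁ X₂ A : Set Z} (h₁ : IsStewart X₁) (hA : IsStewart A)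
    (h₂ : IsStewart X₂) (hA₁ : A ⊆ X₁) (hA₂ : A ⊆ X₂)
    (hcross : ∀ x ∈ X₁, ∀ p ∈ X₂, ∃ a ∈ A, dist p x = dist p a + dist a x)
    {x y c : Z} {t : ℝ} (hx : x ∈ X₁) (hy : y ∈ X₂) (hc : c ∈ A) (ht : 0 ≤ t)
    (hxy : dist x y = dist x c + dist c y) (hpos : 0 < dist x y)
    (htc : t * dist x y ≤ dist x c) :
    ∃ z ∈ X₁, ∀ p ∈ X₁ ∪ X₂, StewartLE x y t z p := by
  obtain ⟨s, hs, hst⟩ : ∃ s ∈ Set.Icc (0 : ℝ) 1, t * dist x y = s * dist x c := by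
    rcases (dist_nonneg (x := x) (y := c)).eq_or_lt with hu | hu
    · rw [← hu] at htc ⊢
      exact ⟨0, by simp, by nlinarith⟩
    · exact ⟨t * dist x y / dist x c, ⟨by positivity, (div_le_one hu).2 htc⟩, by field_simp⟩
  have hcross' : ∀ x ∈ X₂, ∀ p ∈ X₁, ∃ a ∈ A, dist p x = dist p a + dist a x := by
    intro x hx p hp
    obtain ⟨a, ha, h⟩ := hcross p hp x hx
    exact ⟨a, ha, by rw [dist_comm p x, h, dist_comm x a, dist_comm a p, add_comm]⟩
  obtain ⟨z, hz, hz'⟩ := h₁ x hx c (hA₁ hc) s hs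
  refine ⟨z, hz, fun p hp => ?_⟩
  refine stewartLE_of_stewart_at hxy hpos hs hst ?_ ?_
  · rcases hp with hp | hp
    · exact stewart_at_crossing h₁ hA h₂ hA₁ hA₂ hcross hx hy hc hp hxy
    · have hyx : dist y x = dist y c + dist c x := by
        rw [dist_comm y x, hxy, dist_comm y c, dist_comm c x, add_comm]
      have := stewart_at_crossing h₂ hA h₁ hA₂ hA₁ hcross' hy hx hc hp hyx
      rw [dist_comm y c, dist_comm c x] at this
      linarith
  · rcases hp with hp | hp
    · exact hz' p hp
    · exact stewartLE_across h₁ hA h₂ hA₁ hA₂ hcross hx (hA₁ hc) hs hz' hp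

/-- Reshetnyak's gluing theorem: the union of two CAT(0) subspaces glued along a CAT(0)
subspace is CAT(0). -/
theorem IsStewart.glue {X₁ X₂ A : Set Z} (h₁ : IsStewart X₁) (hA : IsStewart A)
    (h₂ : IsStewart X₂) (hA₁ : A ⊆ X₁) (hA₂ : A ⊆ X₂)
    (hcross : ∀ x ∈ X₁, ∀ p ∈ X₂, ∃ a ∈ A, dist p x = dist p a + dist a x) :
    IsStewart (X₁ ∪ X₂) := by
  have hcross' : ∀ x ∈ X₂, ∀ p ∈ X₁, ∃ a ∈ A, dist p x = dist p a + dist a x := by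
    intro x hx p hp
    obtain ⟨a, ha, h⟩ := hcross p hp x hx
    exact ⟨a, ha, by rw [dist_comm p x, h, dist_comm x a, dist_comm a p, add_comm]⟩
  have mixed : ∀ x ∈ X₁, ∀ y ∈ X₂, ∀ t ∈ Set.Icc (0 : ℝ) 1, ∃ z ∈ X₁ ∪ X₂, ∀ p ∈ X₁ ∪ X₂,
      StewartLE x y t z p := by
    intro x hx y hy t ht
    rcases (dist_nonneg (x := x) (y := y)).eq_or_lt with hpos | hpos
    · obtain rfl := dist_eq_zero.1 hpos.symm
      refine ⟨x, Or.inl hx, fun p _ => ?_⟩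
      unfold StewartLE
      rw [dist_self]
      linarith
    obtain ⟨c, hc, hxy⟩ := hcross' y hy x hx
    rcases le_total (t * dist x y) (dist x c) with htc | htc
    · obtain ⟨z, hz, h⟩ := exists_stewartLE_of_crossing h₁ hA h₂ hA₁ hA₂ hcross hx hy hc ht.1 hxy
        hpos htc
      exact ⟨z, Or.inl hz, h⟩
    · obtain ⟨z, hz, h⟩ := exists_stewartLE_of_crossing h₂ hA h₁ hA₂ hA₁ hcross' hy hx hc
        (t := 1 - t) (by linarith [ht.2])
        (by rw [dist_comm y x, hxy, dist_comm y c, dist_comm c x, add_comm])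
        (by rwa [dist_comm]) (by rw [dist_comm y x, dist_comm y c]; linarith)
      refine ⟨z, Or.inr hz, fun p hp => ?_⟩
      simpa using (h p hp.symm).symm
  rintro x (hx | hx) y (hy | hy) t ht
  · obtain ⟨z, hz, hz'⟩ := h₁ x hx y hy t ht
    refine ⟨z, Or.inl hz, fun p hp => hp.elim (hz' p) ?_⟩
    exact stewartLE_across h₁ hA h₂ hA₁ hA₂ hcross hx hy ht hz'
  · exact mixed x hx y hy t ht
  · obtain ⟨z, hz, h⟩ := mixed y hy x hx (1 - t) ⟨by linarith [ht.2], by linarith [ht.1]⟩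
    exact ⟨z, hz, fun p hp => by simpa using (h p hp).symm⟩
  · obtain ⟨z, hz, hz'⟩ := h₂ x hx y hy t ht
    refine ⟨z, Or.inr hz, fun p hp => hp.elim ?_ (hz' p)⟩
    exact stewartLE_across h₂ hA h₁ hA₂ hA₁ hcross' hx hy ht hz'

/-- Balls of a CAT(0) subspace are convex. -/
theorem IsStewart.inter_ball {S : Set Z} (h : IsStewart S) {c : Z} (hc : c ∈ S) (r : ℝ) :
    IsStewart (S ∩ Metric.ball c r) := by
  rintro x ⟨hx, hx'⟩ y ⟨hy, hy'⟩ t ht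
  obtain ⟨z, hz, hz'⟩ := h x hx y hy t ht
  refine ⟨z, ⟨hz, ?_⟩, fun p hp => hz' p hp.1⟩
  rw [Metric.mem_ball'] at hx' hy' ⊢
  have hr : 0 < r := dist_nonneg.trans_lt hx'
  have h1 := hz' c hc
  unfold StewartLE at h1
  have h2 : 0 ≤ t * (1 - t) * dist x y ^ 2 :=
    mul_nonneg (mul_nonneg ht.1 (sub_nonneg.2 ht.2)) (sq_nonneg _)
  have hx2 : dist c x ^ 2 < r ^ 2 := pow_lt_pow_left₀ hx' dist_nonneg two_ne_zero
  have hy2 : dist c y ^ 2 < r ^ 2 := pow_lt_pow_left₀ hy' dist_nonneg two_ne_zero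
  refine lt_of_pow_lt_pow_left₀ 2 hr.le ?_
  rcases ht.1.eq_or_lt with h0 | h0
  · subst h0
    linarith
  · nlinarith [ht.2]

/-- A space isometric to a Stewart subset of a metric space is CAT(0). -/
theorem isCAT0_of_isometry {T : Type v} [PseudoEMetricSpace T] {φ : T → Z} (hφ : Isometry φ)
    (hinj : Function.Injective φ) (hS : IsStewart (Set.range φ)) : IsCAT0 T := by
  have hdist : ∀ x y, edist x y = ENNReal.ofReal (dist (φ x) (φ y)) := fun x y => by
    rw [← edist_dist, hφ.edist_eq]
  -- Intermediate points are unique, so every geodesic passes through the points supplied by `hS`.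
  have stewart_of_geodesic : ∀ (x y : T) (γ : ℝ → T), IsGeodesicSegment γ x y →
      ∀ t ∈ Set.Icc (0 : ℝ) 1, ∀ p, StewartLE (φ x) (φ y) t (φ (γ t)) (φ p) := by
    intro x y γ hγ t ht p
    obtain ⟨z, -, hz⟩ := hS _ ⟨x, rfl⟩ _ ⟨y, rfl⟩ t ht
    have e1 := hγ.edist_eq 0 ⟨le_rfl, zero_le_one⟩ t ht
    have e2 := hγ.edist_eq 1 ⟨zero_le_one, le_rfl⟩ t ht
    rw [hγ.source, hdist, hdist, edist_dist, ← ENNReal.ofReal_mul dist_nonneg,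
      ENNReal.ofReal_eq_ofReal_iff dist_nonneg (by positivity), dist_comm (0 : ℝ),
      Real.dist_0_eq_abs, abs_of_nonneg ht.1] at e1
    rw [hγ.target, hdist, hdist, edist_dist, ← ENNReal.ofReal_mul dist_nonneg,
      ENNReal.ofReal_eq_ofReal_iff dist_nonneg (by positivity), Real.dist_eq,
      abs_of_nonneg (sub_nonneg.2 ht.2)] at e2
    rw [eq_of_stewartLE ht e1.le e2.le (hz _ ⟨γ t, rfl⟩)]
    exact hz _ ⟨p, rfl⟩
  refine ⟨fun x y => by rw [hdist]; exact ENNReal.ofReal_ne_top, fun x y h => hinj ?_,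
    fun x y => ?_, ?_⟩
  · rw [← hφ.edist_eq] at h
    exact edist_eq_zero.1 h
  · have h1 : ∀ t : ℝ, ∃ z : T, t ∈ Set.Icc (0 : ℝ) 1 →
        ∀ p : T, StewartLE (φ x) (φ y) t (φ z) (φ p) := by
      intro t
      by_cases ht : t ∈ Set.Icc (0 : ℝ) 1
      · obtain ⟨_, ⟨z, rfl⟩, hz⟩ := hS _ ⟨x, rfl⟩ _ ⟨y, rfl⟩ t ht
        exact ⟨z, fun _ p => hz _ ⟨p, rfl⟩⟩
      · exact ⟨x, fun h => absurd h ht⟩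
    choose γ hγ using h1
    have hl : ∀ t (ht : t ∈ Set.Icc (0 : ℝ) 1), dist (φ x) (φ (γ t)) ≤ t * dist (φ x) (φ y) :=
      fun t ht => dist_left_of_stewartLE ht (hγ t ht x)
    have hr : ∀ t (ht : t ∈ Set.Icc (0 : ℝ) 1),
        dist (φ y) (φ (γ t)) ≤ (1 - t) * dist (φ x) (φ y) :=
      fun t ht => dist_right_of_stewartLE ht (hγ t ht y)
    have h01 : (0 : ℝ) ∈ Set.Icc (0 : ℝ) 1 := ⟨le_rfl, zero_le_one⟩
    have h11 : (1 : ℝ) ∈ Set.Icc (0 : ℝ) 1 := ⟨zero_le_one, le_rfl⟩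
    -- This is Stewart for `γ t` seen from `γ s`. Equality is forced afterwards by the triangle
    -- inequality along `x`, `γ s`, `γ t`, `y`.
    have hle : ∀ s ∈ Set.Icc (0 : ℝ) 1, ∀ t ∈ Set.Icc (0 : ℝ) 1,
        dist (φ (γ s)) (φ (γ t)) ≤ dist s t * dist (φ x) (φ y) := by
      intro s hs t ht
      have h1 := hγ t ht (γ s)
      unfold StewartLE at h1
      have h2 := pow_le_pow_left₀ dist_nonneg (hl s hs) 2
      have h3 := pow_le_pow_left₀ dist_nonneg (hr s hs) 2
      rw [dist_comm (φ (γ s)) (φ x), dist_comm (φ (γ s)) (φ y)] at h1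
      have h4 := mul_le_mul_of_nonneg_left h2 (sub_nonneg.2 ht.2)
      have h5 := mul_le_mul_of_nonneg_left h3 ht.1
      refine pow_le_pow_iff_left₀ dist_nonneg (by positivity) two_ne_zero |>.1 ?_
      rw [mul_pow, Real.dist_eq, sq_abs]
      linarith
    refine ⟨γ, hinj ?_, hinj ?_, fun s hs t ht => ?_⟩
    · exact (dist_le_zero.1 (by simpa using hl 0 h01)).symm
    · exact (dist_le_zero.1 (by simpa using hr 1 h11)).symm
    · rw [hdist, hdist, edist_dist, ← ENNReal.ofReal_mul dist_nonneg]
      congr 1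
      refine le_antisymm (hle s hs t ht) ?_
      rw [Real.dist_eq]
      rcases le_total s t with hst | hst
      · rw [abs_of_nonpos (sub_nonpos.2 hst)]
        have h1 := dist_triangle4 (φ x) (φ (γ s)) (φ (γ t)) (φ y)
        have h2 := hl s hs
        have h3 := hr t ht
        rw [dist_comm (φ y)] at h3
        linarith
      · rw [abs_of_nonneg (sub_nonneg.2 hst)]
        have h1 := dist_triangle4 (φ x) (φ (γ t)) (φ (γ s)) (φ y)
        have h2 := hl t ht
        have h3 := hr s hs
        rw [dist_comm (φ y)] at h3
        rw [dist_comm (φ (γ s))]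
        linarith
  · intro x y z γ δ hγ hδ x' y' z' hxy hxz hyz s hs t ht
    have e1 := stewart_of_geodesic x z δ hδ t ht (γ s)
    have e2 := stewart_of_geodesic x y γ hγ s hs x
    have e3 := stewart_of_geodesic x y γ hγ s hs z
    have e4 := two_point_of_stewartLE hs ht e2 e3 e1
    rw [hdist, edist_dist, ENNReal.ofReal_eq_ofReal_iff dist_nonneg dist_nonneg] at hxy hxz hyz
    rw [hdist, edist_dist]
    refine ENNReal.ofReal_le_ofReal ?_
    refine pow_le_pow_iff_left₀ dist_nonneg dist_nonneg two_ne_zero |>.1 (e4.trans ?_)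
    rw [← hxy, ← hxz, ← hyz]
    apply le_of_eq
    have e5 : AffineMap.lineMap x' y' s - AffineMap.lineMap x' z' t =
        s • (y' - x') - t • (z' - x') := by
      simp [AffineMap.lineMap_apply]
    have e6 : y' - z' = (y' - x') - (z' - x') := by abel
    rw [dist_comm x' y', dist_comm x' z', dist_eq_norm, dist_eq_norm, dist_eq_norm, dist_eq_norm,
      e5, e6]
    generalize y' - x' = a
    generalize z' - x' = b
    rw [norm_sub_sq_real, norm_sub_sq_real, norm_smul, norm_smul, mul_pow, mul_pow,
      inner_smul_left, inner_smul_right, Real.norm_eq_abs, Real.norm_eq_abs, sq_abs, sq_abs]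
    simp
    ring

end Stewart

/-! ## Orthant spaces -/

/-- The orthant space of a relation on a finite set `H`: one Euclidean orthant for each clique,
glued along common faces. Its points are the vectors in `ℝ^H` with nonnegative coordinates
whose support is a clique. -/
structure OrthantSpace {H : Type u} (adj : H → H → Prop) where
  coords : EuclideanSpace ℝ H
  nonneg : ∀ h, 0 ≤ coords h
  clique : ∀ h k, h ≠ k → coords h ≠ 0 → coords k ≠ 0 → adj h k

namespace OrthantSpace

open Real

variable {H : Type u} {adj : H → H → Prop}

@[ext] theorem ext' {x y : OrthantSpace adj} (h : ∀ k, x.coords k = y.coords k) : x = y := by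
  obtain ⟨x, _, _⟩ := x
  obtain ⟨y, _, _⟩ := y
  obtain rfl : x = y := by
    ext k
    exact h k
  rfl

/-- Two points are compatible if they lie in a common orthant. -/
def Compat (x y : OrthantSpace adj) : Prop :=
  ∀ h k, h ≠ k → (x.coords h ≠ 0 ∨ y.coords h ≠ 0) → (x.coords k ≠ 0 ∨ y.coords k ≠ 0) → adj h k

theorem Compat.symm {x y : OrthantSpace adj} (h : Compat x y) : Compat y x :=
  fun a b hab ha hb => h a b hab ha.symm hb.symm

instance : Zero (OrthantSpace adj) where
  zero := ⟨0, by simp, by simp⟩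

@[simp] theorem coords_zero (k : H) : (0 : OrthantSpace adj).coords k = 0 := rfl

theorem compat_zero (x : OrthantSpace adj) : Compat x 0 := by
  intro h k hk h1 h2
  simp only [coords_zero, ne_eq, not_true_eq_false, or_false] at h1 h2
  exact x.clique h k hk h1 h2

/-- The projection to the orthant subspace of a subset of `H`. -/
noncomputable def restrict (T : Set H) (x : OrthantSpace adj) : OrthantSpace adj where
  coords := WithLp.toLp 2 (T.indicator x.coords)
  nonneg k := Set.indicator_nonneg (fun k _ => x.nonneg k) k
  clique h k hk h1 h2 := x.clique h k hk (fun h3 => h1 (by simp [Set.indicator, h3]))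
    (fun h3 => h2 (by simp [Set.indicator, h3]))

theorem coords_restrict (T : Set H) (x : OrthantSpace adj) (k : H) :
    (restrict T x).coords k = T.indicator x.coords k := rfl

theorem coords_restrict_le (T : Set H) (x : OrthantSpace adj) (k : H) :
    (restrict T x).coords k ≤ x.coords k :=
  Set.indicator_le_self' (fun k _ => x.nonneg k) k

theorem Compat.restrict {x y : OrthantSpace adj} (h : Compat x y) (T : Set H) :
    Compat (x.restrict T) (y.restrict T) := by
  have aux : ∀ k, ((x.restrict T).coords k ≠ 0 ∨ (y.restrict T).coords k ≠ 0) →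
      (x.coords k ≠ 0 ∨ y.coords k ≠ 0) := by
    intro k
    simp only [coords_restrict, Set.indicator]
    split_ifs <;> simp
  exact fun a b hab ha hb => h a b hab (aux a ha) (aux b hb)

/-- The points with support in `T`. -/
def supportedOn (adj : H → H → Prop) (T : Set H) : Set (OrthantSpace adj) :=
  {x | ∀ k, x.coords k ≠ 0 → k ∈ T}

theorem restrict_mem (T : Set H) (x : OrthantSpace adj) : x.restrict T ∈ supportedOn adj T := by
  intro k hk
  by_contra h
  exact hk (by simp [coords_restrict, h])

theorem restrict_of_mem {T : Set H} {x : OrthantSpace adj} (hx : x ∈ supportedOn adj T) :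
    x.restrict T = x := by
  classical
  ext k
  rw [coords_restrict, Set.indicator_apply]
  split_ifs with h
  · rfl
  · by_contra h'
    exact h (hx k (Ne.symm h'))

/-- The elements adjacent to `h`. -/
def link (adj : H → H → Prop) (h : H) : Set H := {k | k ≠ h ∧ adj h k ∧ adj k h}

theorem notMem_link (h : H) : h ∉ link adj h := fun hh => hh.1 rfl

open Classical in
/-- The point with `h`-coordinate `r` whose projection to the link of `h` is that of `x`. -/
noncomputable def suspend (h : H) (r : NNReal) (x : OrthantSpace adj) : OrthantSpace adj where
  coords := WithLp.toLp 2 (Function.update ((x.restrict (link adj h)).coords) h r)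
  nonneg k := by
    by_cases hk : k = h
    · subst hk
      simp
    · simpa [hk] using (x.restrict (link adj h)).nonneg k
  clique a b hab ha hb := by
    by_cases h1 : a = h
    · subst h1
      simp only [Function.update_of_ne hab.symm] at hb
      exact (restrict_mem _ _ _ hb).2.1
    · simp only [Function.update_of_ne h1] at ha
      by_cases h2 : b = h
      · subst h2
        exact (restrict_mem _ _ _ ha).2.2
      · simp only [Function.update_of_ne h2] at hb
        exact (x.restrict (link adj h)).clique a b hab ha hb

theorem coords_suspend_self (h : H) (r : NNReal) (x : OrthantSpace adj) :
    (suspend h r x).coords h = r := by simp [suspend]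

theorem coords_suspend_of_ne {h k : H} (hk : k ≠ h) (r : NNReal) (x : OrthantSpace adj) :
    (suspend h r x).coords k = (x.restrict (link adj h)).coords k := by simp [suspend, hk]

theorem suspend_restrict (h : H) (r : NNReal) (x : OrthantSpace adj) :
    (suspend h r x).restrict (link adj h) = x.restrict (link adj h) := by
  ext k
  by_cases hk : k = h
  · subst hk
    simp [coords_restrict, notMem_link]
  · simp only [coords_restrict, Set.indicator, coords_suspend_of_ne hk]
    split_ifs <;> rfl

theorem compat_suspend {x y : OrthantSpace adj} (hc : Compat x y) (h : H) (r s : NNReal) :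
    Compat (suspend h r x) (suspend h s y) := by
  have aux : ∀ k, k ≠ h → ((suspend h r x).coords k ≠ 0 ∨ (suspend h s y).coords k ≠ 0) →
      k ∈ link adj h ∧ ((x.restrict (link adj h)).coords k ≠ 0 ∨
        (y.restrict (link adj h)).coords k ≠ 0) := by
    intro k hk h1
    rw [coords_suspend_of_ne hk, coords_suspend_of_ne hk] at h1
    exact ⟨h1.elim (restrict_mem _ _ _) (restrict_mem _ _ _), h1⟩
  intro a b hab ha hb
  by_cases h1 : a = h
  · subst h1
    exact (aux b hab.symm hb).1.2.1
  · by_cases h2 : b = h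
    · subst h2
      exact (aux a h1 ha).1.2.2
    · exact hc.restrict (link adj h) a b hab (aux a h1 ha).2 (aux b h2 hb).2

theorem suspend_mem {h : H} {S : Set H} (r : NNReal) {x : OrthantSpace adj}
    (hx : x ∈ supportedOn adj (S ∩ link adj h)) :
    suspend h r x ∈ supportedOn adj (insert h (S ∩ link adj h)) := by
  intro k hk
  by_cases hkh : k = h
  · exact Or.inl hkh
  · rw [coords_suspend_of_ne hkh, coords_restrict] at hk
    exact Or.inr (hx k fun h0 => hk (by simp [Set.indicator, h0]))

theorem exists_suspend_eq {h : H} {S : Set H} {x : OrthantSpace adj}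
    (hx : x ∈ supportedOn adj (insert h (S ∩ link adj h))) :
    ∃ y ∈ supportedOn adj (S ∩ link adj h), ∃ r : NNReal, x = suspend h r y := by
  classical
  refine ⟨x.restrict (S ∩ link adj h), restrict_mem _ _, (x.coords h).toNNReal, ?_⟩
  ext k
  by_cases hkh : k = h
  · subst hkh
    rw [coords_suspend_self, Real.coe_toNNReal _ (x.nonneg k)]
  · rw [coords_suspend_of_ne hkh, coords_restrict, Set.indicator_apply]
    by_cases hk : x.coords k = 0
    · simp [coords_restrict, Set.indicator, hk]
    · have := (hx k hk).resolve_left hkh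
      simp [coords_restrict, Set.indicator, this, this.2]

/-! ### The length metric of an orthant space -/

section Metric

variable [Fintype H]

/-- `IsChain x y l` says that there is a finite sequence of points from `x` to `y`, consecutive
ones of which are compatible, of total Euclidean length `l`. -/
inductive IsChain : OrthantSpace adj → OrthantSpace adj → ℝ → Prop
  | nil (x : OrthantSpace adj) : IsChain x x 0
  | cons (x y z : OrthantSpace adj) (l : ℝ) :
    Compat x y → IsChain y z l → IsChain x z (dist x.coords y.coords + l)

theorem IsChain.append {x y z : OrthantSpace adj} {l m : ℝ} (h : IsChain x y l)
    (h' : IsChain y z m) : IsChain x z (l + m) := by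
  induction h with
  | nil => simpa using h'
  | cons x y z l hc _ ih => rw [add_assoc]; exact .cons _ _ _ _ hc (ih h')

theorem IsChain.single {x y : OrthantSpace adj} (h : Compat x y) :
    IsChain x y (dist x.coords y.coords) := by
  simpa using IsChain.cons x y y 0 h (.nil y)

theorem IsChain.symm {x y : OrthantSpace adj} {l : ℝ} (h : IsChain x y l) : IsChain y x l := by
  induction h with
  | nil => exact .nil _
  | cons x y z l hc _ ih =>
    rw [dist_comm, add_comm]
    exact ih.append (.single hc.symm)

theorem IsChain.le {x y : OrthantSpace adj} {l : ℝ} (h : IsChain x y l) :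
    dist x.coords y.coords ≤ l := by
  induction h with
  | nil => simp
  | cons x y z l hc _ ih => exact (dist_triangle _ y.coords _).trans (by gcongr)

theorem exists_isChain (x y : OrthantSpace adj) : ∃ l, IsChain x y l :=
  ⟨_, (IsChain.single (compat_zero x)).append (IsChain.single (compat_zero y).symm)⟩

theorem bddBelow_isChain (x y : OrthantSpace adj) : BddBelow {l | IsChain x y l} :=
  ⟨0, fun _ h => dist_nonneg.trans h.le⟩

/-- The length metric of an orthant space. -/
noncomputable instance : MetricSpace (OrthantSpace adj) where
  dist x y := sInf {l | IsChain x y l}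
  dist_self x := le_antisymm (csInf_le (bddBelow_isChain x x) (.nil x))
    (le_csInf (exists_isChain x x) fun _ h => dist_nonneg.trans h.le)
  dist_comm x y := by
    congr 1
    ext l
    exact ⟨IsChain.symm, IsChain.symm⟩
  dist_triangle x y z := by
    rw [← csInf_add (s := {l | IsChain x y l}) (t := {l | IsChain y z l}) (exists_isChain x y)
      (bddBelow_isChain x y) (exists_isChain y z) (bddBelow_isChain y z)]
    refine csInf_le_csInf (bddBelow_isChain x z)
      (Set.Nonempty.add (exists_isChain x y) (exists_isChain y z)) ?_
    rintro _ ⟨l, hl, m, hm, rfl⟩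
    exact hl.append hm
  eq_of_dist_eq_zero {x y} h := by
    have h1 : dist x.coords y.coords ≤ 0 := by
      refine le_trans ?_ h.le
      exact le_csInf (exists_isChain x y) fun _ h => h.le
    ext k
    rw [dist_le_zero.1 h1]

theorem IsChain.dist_le {x y : OrthantSpace adj} {l : ℝ} (h : IsChain x y l) : dist x y ≤ l :=
  csInf_le (bddBelow_isChain x y) h

theorem le_dist {x y : OrthantSpace adj} {r : ℝ} (h : ∀ l, IsChain x y l → r ≤ l) :
    r ≤ dist x y :=
  le_csInf (exists_isChain x y) h

theorem exists_isChain_lt {x y : OrthantSpace adj} {r : ℝ} (h : dist x y < r) :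
    ∃ l < r, IsChain x y l := by
  obtain ⟨l, h1, h2⟩ := exists_lt_of_csInf_lt (exists_isChain x y) h
  exact ⟨l, h2, h1⟩

theorem dist_coords_le (x y : OrthantSpace adj) : dist x.coords y.coords ≤ dist x y :=
  le_dist fun _ h => h.le

theorem abs_coords_sub_le (x y : OrthantSpace adj) (h : H) :
    |x.coords h - y.coords h| ≤ dist x y := by
  rw [← Real.dist_eq]
  exact (PiLp.dist_apply_le x.coords y.coords h).trans (dist_coords_le x y)

theorem Compat.dist_eq {x y : OrthantSpace adj} (h : Compat x y) :
    dist x y = dist x.coords y.coords :=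
  le_antisymm (IsChain.single h).dist_le (dist_coords_le x y)

theorem dist_coords_restrict_le (T : Set H) (x y : OrthantSpace adj) :
    dist (x.restrict T).coords (y.restrict T).coords ≤ dist x.coords y.coords := by
  rw [EuclideanSpace.dist_eq, EuclideanSpace.dist_eq]
  gcongr with k
  simp only [coords_restrict, Set.indicator]
  split_ifs <;> simp

/-- Coordinate projections preserve compatibility and do not increase lengths. Every `supportedOn`
subspace is thus a 1-Lipschitz retract, so the induction can run inside one ambient metric. -/
theorem IsChain.dist_restrict_le {x y : OrthantSpace adj} {l : ℝ} (h : IsChain x y l)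
    (T : Set H) : dist (x.restrict T) (y.restrict T) ≤ l := by
  induction h with
  | nil => simp
  | cons x y z l hc _ ih =>
    refine (dist_triangle _ (y.restrict T) _).trans (add_le_add ?_ ih)
    rw [(hc.restrict T).dist_eq]
    exact dist_coords_restrict_le T x y

/-! ### Products with a half-line -/

theorem sqrt_add_sq_add_le (a b c d : ℝ) :
    √((a + c) ^ 2 + (b + d) ^ 2) ≤ √(a ^ 2 + b ^ 2) + √(c ^ 2 + d ^ 2) := by
  have h := norm_add_le (a + b * Complex.I) (c + d * Complex.I)
  rw [Complex.norm_add_mul_I, Complex.norm_add_mul_I] at h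
  have e : (a + b * Complex.I : ℂ) + (c + d * Complex.I) =
      ((a + c : ℝ) : ℂ) + ((b + d : ℝ) : ℂ) * Complex.I := by
    push_cast
    ring
  rwa [e, Complex.norm_add_mul_I] at h

theorem dist_coords_restrict_sq_add_le {h : H} {T : Set H} (hT : h ∉ T) (x y : OrthantSpace adj) :
    dist (x.restrict T).coords (y.restrict T).coords ^ 2 + (x.coords h - y.coords h) ^ 2 ≤
      dist x.coords y.coords ^ 2 := by
  classical
  have e : (x.coords h - y.coords h) ^ 2 =
      ∑ k, if k = h then (x.coords k - y.coords k) ^ 2 else 0 := by simp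
  rw [EuclideanSpace.dist_sq_eq, EuclideanSpace.dist_sq_eq, e, ← Finset.sum_add_distrib]
  refine Finset.sum_le_sum fun k _ => ?_
  simp only [coords_restrict, Set.indicator, Real.dist_eq, sq_abs]
  by_cases hk : k = h
  · subst hk
    simp [hT]
  · by_cases hk' : k ∈ T <;> simp [hk, hk', sq_nonneg]

/-- Each step of the chain is at least the hypotenuse over its projection to `T` and its change of
`h`-coordinate; Minkowski's inequality in the plane adds up the hypotenuses. -/
theorem IsChain.sqrt_le {x y : OrthantSpace adj} {l : ℝ} (hl : IsChain x y l) {h : H} {T : Set H}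
    (hT : h ∉ T) :
    √(dist (x.restrict T) (y.restrict T) ^ 2 + (x.coords h - y.coords h) ^ 2) ≤ l := by
  induction hl with
  | nil => simp
  | cons x y z l hc _ ih =>
    refine le_trans ?_ (add_le_add (a := √(dist (x.restrict T) (y.restrict T) ^ 2 +
      (x.coords h - y.coords h) ^ 2)) ?_ ih)
    · refine le_trans ?_ (sqrt_add_sq_add_le _ _ _ _)
      have := dist_triangle (x.restrict T) (y.restrict T) (z.restrict T)
      apply Real.sqrt_le_sqrt
      rw [sub_add_sub_cancel]
      gcongr
    · rw [(hc.restrict T).dist_eq]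
      exact Real.sqrt_le_iff.2 ⟨dist_nonneg, dist_coords_restrict_sq_add_le hT x y⟩

theorem dist_coords_suspend (h : H) (r s : NNReal) (x y : OrthantSpace adj) :
    dist (suspend h r x).coords (suspend h s y).coords ^ 2 =
      dist (x.restrict (link adj h)).coords (y.restrict (link adj h)).coords ^ 2 +
        ((r : ℝ) - s) ^ 2 := by
  classical
  have e : ((r : ℝ) - s) ^ 2 = ∑ k, if k = h then ((r : ℝ) - s) ^ 2 else 0 := by simp
  rw [EuclideanSpace.dist_sq_eq, EuclideanSpace.dist_sq_eq, e, ← Finset.sum_add_distrib]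
  refine Finset.sum_congr rfl fun k _ => ?_
  by_cases hk : k = h
  · subst hk
    simp [coords_suspend_self, coords_restrict, notMem_link, Real.dist_eq]
  · simp [coords_suspend_of_ne hk, hk]

/-- The change of height is spread along the chain in proportion to length, so all steps have the
same slope and their hypotenuses add up exactly. A chain of length zero has no proportions and is
treated apart. -/
theorem IsChain.dist_suspend_le {x y : OrthantSpace adj} {l : ℝ} (hl : IsChain x y l) (h : H)
    (r s : NNReal) : dist (suspend h r x) (suspend h s y) ≤ √(l ^ 2 + ((r : ℝ) - s) ^ 2) := by
  induction hl generalizing r with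
  | nil x =>
    apply Real.le_sqrt_of_sq_le
    rw [(compat_suspend (fun a b hab ha hb => x.clique a b hab (by simpa using ha)
      (by simpa using hb)) h r s).dist_eq, dist_coords_suspend]
    simp
  | cons x y z l hc hl ih =>
    have hl0 : 0 ≤ l := dist_nonneg.trans hl.le
    set e := dist x.coords y.coords
    have he0 : 0 ≤ e := dist_nonneg
    have first : ∀ q : NNReal, dist (suspend h r x) (suspend h q y) ≤
        √(e ^ 2 + ((r : ℝ) - q) ^ 2) := by
      intro q
      apply Real.le_sqrt_of_sq_le
      rw [(compat_suspend hc h r q).dist_eq, dist_coords_suspend]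
      have := dist_coords_restrict_le (link adj h) x y
      gcongr
    rcases (add_nonneg he0 hl0).eq_or_lt with h0 | h0
    · have he : e = 0 := by linarith
      have hl : l = 0 := by linarith
      have h1 := first r
      have h2 := ih r
      have h3 := dist_triangle (suspend h r x) (suspend h r y) (suspend h s z)
      rw [hl] at h2
      rw [he] at h1
      rw [he, hl]
      simp only [sub_self, ne_eq, OfNat.ofNat_ne_zero, not_false_eq_true, zero_pow, add_zero,
        Real.sqrt_zero] at h1
      simp only [add_zero] at *
      linarith
    · set c := e / (e + l) with hc'
      have hc0 : 0 ≤ c := by positivity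
      have hc1 : c ≤ 1 := (div_le_one h0).2 (by linarith)
      obtain ⟨q, hq⟩ : ∃ q : NNReal, (q : ℝ) = (1 - c) * r + c * s := by
        have := sub_nonneg.2 hc1
        exact ⟨_, Real.coe_toNNReal _ (by positivity)⟩
      have hqr : (r : ℝ) - q = c * (r - s) := by
        rw [hq]
        ring
      have hqs : (q : ℝ) - s = (1 - c) * (r - s) := by
        rw [hq]
        ring
      have hce : e = c * (e + l) := by
        rw [hc']
        field_simp
      have hcl : l = (1 - c) * (e + l) := by linarith
      have h1 := first q
      have h2 := ih q
      have h3 := dist_triangle (suspend h r x) (suspend h q y) (suspend h s z)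
      have e1 : √(e ^ 2 + ((r : ℝ) - q) ^ 2) = c * √((e + l) ^ 2 + ((r : ℝ) - s) ^ 2) := by
        rw [hqr, ← Real.sqrt_sq hc0, ← Real.sqrt_mul (sq_nonneg c), Real.sqrt_sq hc0]
        congr 1
        nth_rewrite 1 [hce]
        ring
      have e2 : √(l ^ 2 + ((q : ℝ) - s) ^ 2) = (1 - c) * √((e + l) ^ 2 + ((r : ℝ) - s) ^ 2) := by
        have h10 := sub_nonneg.2 hc1
        rw [hqs, ← Real.sqrt_sq h10, ← Real.sqrt_mul (sq_nonneg (1 - c)), Real.sqrt_sq h10]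
        congr 1
        nth_rewrite 1 [hcl]
        ring
      rw [e1] at h1
      rw [e2] at h2
      linarith

/-- The link of `h`, times a half-line, is embedded as a metric product. -/
theorem dist_suspend_sq (h : H) (r s : NNReal) {x y : OrthantSpace adj}
    (hx : x ∈ supportedOn adj (link adj h)) (hy : y ∈ supportedOn adj (link adj h)) :
    dist (suspend h r x) (suspend h s y) ^ 2 = dist x y ^ 2 + ((r : ℝ) - s) ^ 2 := by
  refine le_antisymm ?_ ?_
  · have h1 : ∀ l, dist x y < l →
        dist (suspend h r x) (suspend h s y) ^ 2 ≤ l ^ 2 + ((r : ℝ) - s) ^ 2 := by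
      intro l hl
      obtain ⟨m, hm, hm'⟩ := exists_isChain_lt hl
      have h2 := hm'.dist_suspend_le h r s
      have h3 := (Real.le_sqrt dist_nonneg (by positivity)).1 h2
      have h4 : 0 ≤ m := dist_nonneg.trans hm'.le
      refine h3.trans ?_
      gcongr
    have h2 : Filter.Tendsto (fun l : ℝ => l ^ 2 + ((r : ℝ) - s) ^ 2)
        (nhdsWithin (dist x y) (Set.Ioi (dist x y))) (nhds (dist x y ^ 2 + ((r : ℝ) - s) ^ 2)) :=
      (Continuous.tendsto (by fun_prop) _).mono_left nhdsWithin_le_nhds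
    exact ge_of_tendsto h2 (Filter.eventually_of_mem self_mem_nhdsWithin h1)
  · have h1 : √(dist x y ^ 2 + ((r : ℝ) - s) ^ 2) ≤ dist (suspend h r x) (suspend h s y) := by
      refine le_dist fun l hl => ?_
      have := hl.sqrt_le (notMem_link (adj := adj) h)
      rwa [suspend_restrict, suspend_restrict, restrict_of_mem hx, restrict_of_mem hy,
        coords_suspend_self, coords_suspend_self] at this
    exact (Real.sqrt_le_left dist_nonneg).1 h1

/-- Squared distances add in a product, and on the half-line Stewart's inequality is an equality;
intermediate points are taken in each factor. -/
theorem isStewart_product {h : H} {S : Set H}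
    (hA : IsStewart (supportedOn adj (S ∩ link adj h))) :
    IsStewart (supportedOn adj (insert h (S ∩ link adj h))) := by
  have hsub : ∀ x ∈ supportedOn adj (S ∩ link adj h), x ∈ supportedOn adj (link adj h) :=
    fun x hx k hk => (hx k hk).2
  intro x' hx y' hy t ht
  obtain ⟨x, hxA, r, rfl⟩ := exists_suspend_eq hx
  obtain ⟨y, hyA, s, rfl⟩ := exists_suspend_eq hy
  clear hx hy
  obtain ⟨z, hz, hz'⟩ := hA x hxA y hyA t ht
  have ht1 := sub_nonneg.2 ht.2
  have ht0 := ht.1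
  obtain ⟨c, hc⟩ : ∃ c : NNReal, (c : ℝ) = (1 - t) * r + t * s :=
    ⟨_, Real.coe_toNNReal _ (by positivity)⟩
  refine ⟨suspend h c z, suspend_mem _ hz, fun p' hp' => ?_⟩
  obtain ⟨p, hp, q, rfl⟩ := exists_suspend_eq hp'
  have := hz' p hp
  unfold StewartLE at *
  rw [dist_suspend_sq h _ _ (hsub p hp) (hsub z hz), dist_suspend_sq h _ _ (hsub p hp) (hsub x hxA),
    dist_suspend_sq h _ _ (hsub p hp) (hsub y hyA),
    dist_suspend_sq h _ _ (hsub x hxA) (hsub y hyA), hc]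
  linarith

/-! ### Crossing -/

/-- The crossing point is the last one before the `h`-coordinate first becomes nonzero: it shares an
orthant with its successor, so its support lies in the link of `h`. -/
theorem IsChain.exists_crossing {x y : OrthantSpace adj} {l : ℝ} (hl : IsChain x y l) {h : H}
    (hx : x.coords h = 0) (hy : y.coords h ≠ 0) :
    ∃ a ∈ supportedOn adj (link adj h), ∃ l₁ l₂, IsChain x a l₁ ∧ IsChain a y l₂ ∧ l = l₁ + l₂ := by
  induction hl with
  | nil => exact absurd hx hy
  | cons x y z l hc hl ih =>
    by_cases h0 : y.coords h = 0
    · obtain ⟨a, ha, l₁, l₂, h1, h2, h3⟩ := ih h0 hy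
      exact ⟨a, ha, _, l₂, .cons _ _ _ _ hc h1, h2, by rw [h3, add_assoc]⟩
    · refine ⟨x, fun k hk => ?_, 0, _, .nil x, .cons _ _ _ _ hc hl, by simp⟩
      have hkh : k ≠ h := by
        rintro rfl
        exact hk hx
      exact ⟨hkh, hc h k hkh.symm (Or.inr h0) (Or.inl hk), hc k h hkh (Or.inl hk) (Or.inr h0)⟩

theorem exists_dist_add_dist_lt {h : H} {S : Set H} {x p : OrthantSpace adj} (hS : h ∉ S)
    (hx : x ∈ supportedOn adj S) (hp : p ∈ supportedOn adj (insert h (S ∩ link adj h)))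
    {r : ℝ} (hr : dist p x < r) :
    ∃ a ∈ supportedOn adj (S ∩ link adj h), dist p a + dist a x < r := by
  by_cases h0 : p.coords h = 0
  · refine ⟨p, fun k hk => (hp k hk).resolve_left ?_, by simpa using hr⟩
    rintro rfl
    exact hk h0
  · rw [dist_comm] at hr
    obtain ⟨l, hl, hl'⟩ := exists_isChain_lt hr
    have hxh : x.coords h = 0 := by
      by_contra h1
      exact hS (hx h h1)
    obtain ⟨a, ha, l₁, l₂, h1, h2, h3⟩ := hl'.exists_crossing hxh h0
    -- The crossing point may have coordinates outside `S`. Project the part of the chain from `x`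
    -- to `S` and the part to `p` to `insert h S`: the ends are fixed, and the projections of `a`
    -- agree because its `h`-coordinate vanishes.
    have e1 := h1.dist_restrict_le S
    have e2 := h2.dist_restrict_le (insert h S)
    have hah : a.coords h = 0 := by
      by_contra h1
      exact notMem_link h (ha h h1)
    have e3 : a.restrict (insert h S) = a.restrict S := by
      ext k
      by_cases hk : k = h
      · subst hk
        simp [coords_restrict, Set.indicator, hah]
      · by_cases hkS : k ∈ S <;> simp [coords_restrict, Set.indicator, hk, hkS]
    rw [restrict_of_mem hx] at e1
    have hp' : p ∈ supportedOn adj (insert h S) := fun k hk => (hp k hk).imp id And.left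
    rw [e3, restrict_of_mem hp'] at e2
    refine ⟨a.restrict S, fun k hk => ⟨restrict_mem _ _ k hk, ha k fun h0 => hk ?_⟩, ?_⟩
    · simp [coords_restrict, Set.indicator, h0]
    · rw [dist_comm p, dist_comm _ x]
      linarith

/-- On a single orthant the metric is Euclidean, and the set is a finite union of truncated
orthants, one for each clique in `T`. -/
theorem isCompact_supportedOn_inter (T : Set H) (C : ℝ) :
    IsCompact {a : OrthantSpace adj | a ∈ supportedOn adj T ∧ ‖a.coords‖ ≤ C} := by
  have key : ∀ σ : Set H, (∀ h ∈ σ, ∀ k ∈ σ, h ≠ k → adj h k) →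
      IsCompact {a : OrthantSpace adj | a ∈ supportedOn adj σ ∧ ‖a.coords‖ ≤ C} := by
    intro σ hσ
    have hK : IsCompact {v : EuclideanSpace ℝ H | (∀ k, 0 ≤ v k) ∧ (∀ k ∉ σ, v k = 0) ∧
        v ∈ Metric.closedBall 0 C} := by
      have h1 : IsClosed {v : EuclideanSpace ℝ H | ∀ k, 0 ≤ v k} := by
        simp only [Set.ofPred_forall]
        exact isClosed_iInter fun k => isClosed_le (by fun_prop) (by fun_prop)
      have h2 : IsClosed {v : EuclideanSpace ℝ H | ∀ k ∉ σ, v k = 0} := by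
        simp only [Set.ofPred_forall]
        exact isClosed_iInter fun k => isClosed_iInter fun _ =>
          isClosed_eq (by fun_prop) (by fun_prop)
      exact ((isCompact_closedBall 0 C).inter_left h2).inter_left h1
    have hcl : ∀ v : EuclideanSpace ℝ H, (∀ k ∉ σ, v k = 0) → ∀ h k, h ≠ k → v h ≠ 0 → v k ≠ 0 →
        adj h k := fun v hv h k hk h1 h2 =>
      hσ h (by_contra fun h' => h1 (hv h h')) k (by_contra fun h' => h2 (hv k h')) hk
    let f : {v : EuclideanSpace ℝ H | (∀ k, 0 ≤ v k) ∧ (∀ k ∉ σ, v k = 0) ∧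
        v ∈ Metric.closedBall 0 C} → OrthantSpace adj := fun v =>
      ⟨v.1, v.2.1, hcl v.1 v.2.2.1⟩
    have hf : Isometry f := by
      refine Isometry.of_dist_eq fun v w => ?_
      have hc : Compat (f v) (f w) := fun h k hk h1 h2 =>
        hσ h (by_contra fun h' => h1.elim (fun h3 => h3 (v.2.2.1 h h')) fun h3 => h3 (w.2.2.1 h h'))
          k (by_contra fun h' => h2.elim (fun h3 => h3 (v.2.2.1 k h')) fun h3 =>
            h3 (w.2.2.1 k h')) hk
      rw [hc.dist_eq]
      rfl
    have := isCompact_iff_compactSpace.1 hK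
    convert isCompact_range hf.continuous using 1
    ext a
    constructor
    · rintro ⟨h1, h2⟩
      exact ⟨⟨a.coords, a.nonneg, fun k hk => by_contra fun h => hk (h1 k h), by simpa using h2⟩,
        rfl⟩
    · rintro ⟨v, rfl⟩
      exact ⟨fun k hk => by_contra fun h => hk (v.2.2.1 k h), by simpa using v.2.2.2⟩
  have hU : {a : OrthantSpace adj | a ∈ supportedOn adj T ∧ ‖a.coords‖ ≤ C} =
      ⋃ σ ∈ {σ : Set H | σ ⊆ T ∧ ∀ h ∈ σ, ∀ k ∈ σ, h ≠ k → adj h k},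
        {a : OrthantSpace adj | a ∈ supportedOn adj σ ∧ ‖a.coords‖ ≤ C} := by
    ext a
    simp only [Set.mem_iUnion, Set.mem_ofPred_eq, exists_prop]
    constructor
    · rintro ⟨h1, h2⟩
      exact ⟨{k | a.coords k ≠ 0}, ⟨h1, fun h hh k hk hne => a.clique h k hne hh hk⟩,
        fun k hk => hk, h2⟩
    · rintro ⟨σ, ⟨h1, -⟩, h2, h3⟩
      exact ⟨fun k hk => h1 (h2 k hk), h3⟩
  rw [hU]
  exact (Set.toFinite _).isCompact_biUnion fun σ hσ => key σ hσ.2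

theorem exists_dist_eq_add {h : H} {S : Set H} {x p : OrthantSpace adj} (hS : h ∉ S)
    (hx : x ∈ supportedOn adj S) (hp : p ∈ supportedOn adj (insert h (S ∩ link adj h))) :
    ∃ a ∈ supportedOn adj (S ∩ link adj h), dist p x = dist p a + dist a x := by
  have h0 : (0 : OrthantSpace adj) ∈ supportedOn adj (S ∩ link adj h) := fun k hk =>
    absurd (coords_zero k) hk
  -- Beyond norm `C` the distance to `x` alone exceeds the value of the sum at the apex, so the
  -- minimum over this ball is global.
  set C := dist p 0 + dist 0 x + ‖x.coords‖ with hC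
  obtain ⟨a, ha, hmin⟩ := (isCompact_supportedOn_inter (S ∩ link adj h) C).exists_isMinOn
    (f := fun a => dist p a + dist a x) ⟨0, h0, by
      change ‖(0 : EuclideanSpace ℝ H)‖ ≤ C
      rw [norm_zero]
      positivity⟩ (by fun_prop)
  have hle : ∀ b ∈ supportedOn adj (S ∩ link adj h), dist p a + dist a x ≤ dist p b + dist b x := by
    intro b hb
    by_cases hbC : ‖b.coords‖ ≤ C
    · exact hmin ⟨hb, hbC⟩
    · have h1 : dist p a + dist a x ≤ dist p 0 + dist 0 x := hmin ⟨h0, by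
        change ‖(0 : EuclideanSpace ℝ H)‖ ≤ C
        rw [norm_zero]
        positivity⟩
      have h2 := dist_coords_le b x
      have h3 := norm_sub_norm_le b.coords x.coords
      rw [← dist_eq_norm] at h3
      have h4 := dist_nonneg (x := p) (y := b)
      linarith
  refine ⟨a, ha.1, le_antisymm (dist_triangle _ _ _) ?_⟩
  refine le_of_forall_gt fun r hr => ?_
  obtain ⟨b, hb, hb'⟩ := exists_dist_add_dist_lt hS hx hp hr
  exact (hle b hb).trans_lt hb'

/-- Orthant spaces are CAT(0). -/
theorem isStewart_supportedOn (S : Finset H) : IsStewart (supportedOn adj (S : Set H)) := by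
  classical
  induction S using Finset.strongInduction with
  | H S ih =>
    rcases S.eq_empty_or_nonempty with rfl | ⟨h, hh⟩
    · intro x hx y hy t ht
      have hz : ∀ x ∈ supportedOn adj (((∅ : Finset H)) : Set H), x = 0 := by
        intro x hx
        ext k
        by_contra h
        simpa using hx k h
      refine ⟨x, hx, fun p hp => ?_⟩
      rw [hz x hx, hz y hy, hz p hp]
      simp [StewartLE]
    · have hsub : S.erase h ⊂ S := Finset.erase_ssubset hh
      have h1 := ih _ hsub
      have h2 := ih ((S.erase h).filter (· ∈ link adj h))
        ((Finset.filter_subset _ _).trans_ssubset hsub)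
      have e2 : (((S.erase h).filter (· ∈ link adj h) : Finset H) : Set H) =
          ((S.erase h : Finset H) : Set H) ∩ link adj h := by
        ext k
        simp only [Finset.coe_filter, Set.mem_inter_iff, Finset.mem_coe]
        rfl
      rw [e2] at h2
      have hS : h ∉ ((S.erase h : Finset H) : Set H) := by simp
      -- A nonzero `h`-coordinate forces the rest of the support into the link of `h`, so the two
      -- pieces cover everything.
      have := h1.glue h2 (isStewart_product h2) (fun x hx k hk => (hx k hk).1)
        (fun x hx k hk => Or.inr (hx k hk)) fun x hx p hp => exists_dist_eq_add hS hx hp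
      convert this using 1
      ext x
      constructor
      · intro hx
        by_cases h0 : x.coords h = 0
        · refine Or.inl fun k hk => ?_
          have : k ≠ h := by
            rintro rfl
            exact hk h0
          simpa [this] using hx k hk
        · refine Or.inr fun k hk => ?_
          by_cases hkh : k = h
          · exact Or.inl hkh
          · exact Or.inr ⟨by simpa [hkh] using hx k hk, hkh, x.clique _ _ (Ne.symm hkh) h0 hk,
              x.clique _ _ hkh hk h0⟩
      · rintro (hx | hx) k hk
        · exact Finset.mem_of_mem_erase (hx k hk)
        · rcases hx k hk with rfl | h3
          · exact hh
          · exact Finset.mem_of_mem_erase h3.1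

end Metric

end OrthantSpace

namespace WhiteheadPartition

/-! ## Regions -/

/-! ### Adjacency across a partition, and nested sides -/

section Sides

variable {V : Type u} {Γ : SimpleGraph V} (p q : WhiteheadPartition Γ)

theorem inv_mem_side_of_not_single' {v : V} (hv : v ∉ p.single) {s b : Bool}
    (h : (v, s) ∈ p.side b) : (v, !s) ∈ p.side b := by
  rcases p.mem_side_or (x := (v, !s)) (p.notMem_lk_of_mem_side h :) b with h1 | h1
  · exact h1
  · refine absurd ?_ hv
    cases s
    · exact ⟨!b, h1, by simpa using h⟩
    · exact ⟨b, h, h1⟩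

/-- Suppose `x ∈ P` and `y ∈ P*` are adjacent. Then `x` is not a singleton, as otherwise `y` would
be in the link. So both `x` and its inverse are in `P`, neither vertex is in the star of `m`, and
the component condition puts `y` in `P`. -/
theorem not_adj_of_mem_sides {x y : V × Bool} {b : Bool} (hx : x ∈ p.side b)
    (hy : y ∈ p.side (!b)) : ¬ Γ.Adj x.1 y.1 := by
  suffices h : ∀ x y : V × Bool, x ∈ p.side false → y ∈ p.side true → ¬ Γ.Adj x.1 y.1 by
    cases b
    · exact h x y hx hy
    · exact fun h' => h y x hy hx h'.symm
  intro x y hx hy hadj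
  obtain ⟨m, hm⟩ := p.exists_pair
  have hxlk := p.notMem_lk_of_mem_side hx
  have hylk := p.notMem_lk_of_mem_side hy
  have hxs : x.1 ∉ p.single := fun h => hylk (p.mem_lk_of_adj_single h hadj)
  have hx' := p.inv_mem_side_of_not_single' hxs hx
  have hboth : ∀ s, (x.1, s) ∈ p.P := by
    intro s
    rcases Bool.eq_or_eq_not s x.2 with rfl | rfl
    · exact hx
    · exact hx'
  rw [p.lk_eq hm] at hxlk hylk
  have hxm : x.1 ≠ m.1 := by
    intro h
    exact hm.inv_notMem (h ▸ hboth _)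
  have hym : y.1 ≠ m.1 := by
    intro h
    rw [h] at hadj
    exact hxlk hadj.symm
  have hx1 : x.1 ∈ (insert m.1 (Γ.neighborSet m.1))ᶜ := fun h => h.elim hxm hxlk
  have hy1 : y.1 ∈ (insert m.1 (Γ.neighborSet m.1))ᶜ := fun h => h.elim hym hylk
  have hreach : (Γ.induce (insert m.1 (Γ.neighborSet m.1))ᶜ).Reachable ⟨x.1, hx1⟩ ⟨y.1, hy1⟩ :=
    SimpleGraph.Adj.reachable hadj
  have := hm.component x.1 y.1 (hboth _) (hboth _) ⟨hx1, hy1, hreach⟩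
  refine hy.1 ?_
  rcases y with ⟨y, _ | _⟩
  · exact this.2
  · exact this.1

theorem base_mem_single {m : V × Bool} (hm : IsWhiteheadPair Γ p.P m) : m.1 ∈ p.single := by
  have h1 : m.1 ∉ p.lk := by
    rw [p.lk_eq hm]
    exact Γ.irrefl
  rcases m with ⟨m, _ | _⟩
  · exact ⟨true, ⟨hm.inv_notMem, h1⟩, hm.mem⟩
  · exact ⟨false, hm.mem, hm.inv_notMem, h1⟩

theorem exists_mem_side_of_single {v : V} (hv : v ∈ p.single) (b : Bool) :
    ∃ s, (v, s) ∈ p.side b := by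
  obtain ⟨c, h1, h2⟩ := hv
  rcases Bool.eq_or_eq_not b c with rfl | rfl
  · exact ⟨_, h1⟩
  · exact ⟨_, h2⟩

theorem side_nonempty (b : Bool) : (p.side b).Nonempty := by
  obtain ⟨m, hm⟩ := p.exists_pair
  obtain ⟨s, hs⟩ := p.exists_mem_side_of_single (p.base_mem_single hm) b
  exact ⟨_, hs⟩

variable {p q}

theorem notMem_lk_of_not_commutes (h : ¬ p.Commutes q) {v : V} (hv : v ∈ p.single) :
    v ∉ q.lk :=
  fun hq => h (commutes_of_single_of_mem_lk p q hv hq)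

/-- Only `lk(q)` could obstruct. An `x` there is adjacent to a base `n` of `q`; an element of `n^±`
lies in `q.side b`, hence across `p` from `x`, which contradicts `not_adj_of_mem_sides`. -/
theorem side_subset_of_disjoint {a b : Bool} (h : p.side a ∩ q.side b = ∅)
    (hc : ¬ p.Commutes q) : p.side a ⊆ q.side (!b) := by
  intro x hx
  have hlk : x.1 ∉ q.lk := by
    rintro ⟨n, hn, hadj⟩
    have hns := q.base_mem_single hn
    obtain ⟨s, hs⟩ := q.exists_mem_side_of_single hns b
    have hnp : n.1 ∉ p.lk := notMem_lk_of_not_commutes (fun h => hc h.symm) hns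
    rcases p.mem_side_or (x := (n.1, s)) hnp a with h1 | h1
    · exact (Set.eq_empty_iff_forall_notMem.1 h _) ⟨h1, hs⟩
    · exact p.not_adj_of_mem_sides hx h1 hadj.symm
  exact (q.mem_side_or hlk b).resolve_left fun h1 =>
    Set.eq_empty_iff_forall_notMem.1 h x ⟨hx, h1⟩

/-- A base of `q` is a singleton of `p` as well, since the common side separates it from its
inverse; neighbours of a singleton lie in the link. -/
theorem lk_subset_of_side_eq {a b : Bool} (h : p.side a = q.side b) (hc : ¬ p.Commutes q) :
    q.lk ⊆ p.lk := by
  obtain ⟨n, hn⟩ := q.exists_pair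
  have hns := q.base_mem_single hn
  have hnp : n.1 ∉ p.lk := notMem_lk_of_not_commutes (fun h => hc h.symm) hns
  obtain ⟨s, hs⟩ := q.exists_mem_side_of_single hns b
  have h1 := q.inv_mem_side_of_single hns hs
  have h2 : (n.1, !s) ∈ p.side (!a) := (p.mem_side_or (x := (n.1, !s)) hnp a).resolve_left
    fun h3 => q.notMem_side_not h1 (by rw [Bool.not_not, ← h]; exact h3)
  have h3 : n.1 ∈ p.single := by
    rw [← h] at hs
    cases s
    · exact ⟨!a, h2, by simpa using hs⟩
    · exact ⟨a, hs, h2⟩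
  rw [q.lk_eq hn]
  exact fun v hv => p.mem_lk_of_adj_single h3 hv

theorem side_not_subset {a b : Bool} (h : p.side a = q.side b) (hlk : q.lk ⊆ p.lk) :
    p.side (!a) ⊆ q.side (!b) := by
  intro x hx
  refine (q.mem_side_or (fun h1 => p.notMem_lk_of_mem_side hx (hlk h1)) b).resolve_left fun h1 => ?_
  rw [← h] at h1
  exact p.notMem_side_not h1 hx

theorem blocks_eq_of_side_eq {a b : Bool} (h : p.side a = q.side b) (hc : ¬ p.Commutes q) :
    p.blocks = q.blocks := by
  have h1 := lk_subset_of_side_eq h hc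
  have h2 := lk_subset_of_side_eq h.symm fun h' => hc h'.symm
  have hlk := h1.antisymm h2
  have hnot := (side_not_subset h h1).antisymm (side_not_subset h.symm h2)
  have hblocks : ∀ (r : WhiteheadPartition Γ) (c : Bool),
      r.blocks = {r.side c, {x | x.1 ∈ r.lk}, r.side (!c)} := by
    intro r c
    cases c
    · rfl
    · simp only [blocks, Bool.not_true]
      rw [Set.insert_comm, Set.pair_comm (r.side false), Set.insert_comm]
  rw [hblocks p a, hblocks q b, h, hnot, hlk]

end Sides

/-! ### Existence of regions and paths between them -/

section RegionPaths

variable {V : Type u} {Γ : SimpleGraph V} {k : ℕ} {W : Fin k → WhiteheadPartition Γ}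

theorem switch_inr_self (i : Fin k) (R : Fin k → Bool) : switch W (Sum.inr i) R i = !R i := by
  simp [switch, Switches]

theorem switch_inr_of_ne {i j : Fin k} (h : j ≠ i) (R : Fin k → Bool) :
    switch W (Sum.inr i) R j = R j := by
  simp [switch, Switches, h]

theorem switch_self (a : V ⊕ Fin k) (R : Fin k → Bool) : switch W a (switch W a R) = R := by
  funext i
  simp only [switch]
  split_ifs <;> simp

theorem isRegion_switch_inr {R : Fin k → Bool} (hR : IsRegion W R) {i : Fin k}
    (h : ∀ j, j ≠ i → (W i).Commutes (W j) ∨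
      ((W i).side (!R i) ∩ (W j).side (R j)).Nonempty) :
    IsRegion W (switch W (Sum.inr i) R) := by
  intro r s hrs
  by_cases hr : r = i
  · subst hr
    rw [switch_inr_self, switch_inr_of_ne hrs.symm]
    exact h s hrs.symm
  · by_cases hs : s = i
    · subst hs
      rw [switch_inr_self, switch_inr_of_ne hrs, Set.inter_comm]
      exact (h r hrs).imp_left Commutes.symm
    · rw [switch_inr_of_ne hr, switch_inr_of_ne hs]
      exact hR r s hrs

/-- Choose `i` with the smallest side in `R` among the indices where `R` and `R'` differ. If some
`j` blocks the switch, its side in `R` is contained in that of `i`, and `j` is also an index of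
difference because `R'` is a region. Minimality then makes the two sides equal, hence also the
partitions. -/
theorem exists_isRegion_switch [Finite V] (hW : IsCompatibleSet W) {R R' : Fin k → Bool}
    (hR : IsRegion W R) (hR' : IsRegion W R') (hne : R ≠ R') :
    ∃ i, R i ≠ R' i ∧ IsRegion W (switch W (Sum.inr i) R) := by
  obtain ⟨i, hi, hmin⟩ := Set.exists_min_image {i | R i ≠ R' i}
    (fun i => ((W i).side (R i)).ncard) (Set.toFinite _) (Function.ne_iff.1 hne)
  refine ⟨i, hi, isRegion_switch_inr hR fun j hji => ?_⟩
  by_contra hcon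
  rw [not_or, Set.not_nonempty_iff_eq_empty, Set.inter_comm] at hcon
  obtain ⟨hc, hemp⟩ := hcon
  have hc' : ¬ (W j).Commutes (W i) := fun h => hc h.symm
  have hj : R j ≠ R' j := by
    intro h
    have h1 := (hR' i j hji.symm).resolve_left hc
    rw [← h, ← (Bool.eq_not.2 hi.symm : R' i = !R i).symm, Set.inter_comm] at h1
    exact h1.ne_empty hemp
  have hsub := side_subset_of_disjoint hemp hc'
  rw [Bool.not_not] at hsub
  exact hW.blocks_ne j i hji (blocks_eq_of_side_eq
    (Set.eq_of_subset_of_ncard_le hsub (hmin j hj) (Set.toFinite _)) hc')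

/-- Any two regions are joined by switching one after the other the sides of the partitions by
which they differ. -/
theorem region_induction [Finite V] (hW : IsCompatibleSet W) {R' : Fin k → Bool}
    (hR' : IsRegion W R') {motive : (Fin k → Bool) → Prop} (refl : motive R')
    (step : ∀ R, IsRegion W R → ∀ i, R i ≠ R' i → IsRegion W (switch W (Sum.inr i) R) →
      motive (switch W (Sum.inr i) R) → motive R) :
    ∀ R, IsRegion W R → motive R := by
  have key : ∀ (n : ℕ) (R : Fin k → Bool), (Finset.univ.filter fun i => R i ≠ R' i).card = n →
      IsRegion W R → motive R := by
    intro n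
    induction n using Nat.strong_induction_on with
    | _ n ih =>
      rintro R rfl hR
      by_cases hne : R = R'
      · exact hne ▸ refl
      · obtain ⟨i, hi, hi'⟩ := exists_isRegion_switch hW hR hR' hne
        refine step R hR i hi hi' (ih _ (Finset.card_lt_card ?_) _ rfl hi')
        refine Finset.ssubset_iff_of_subset (fun j hj => ?_) |>.2 ⟨i, by simpa using hi, ?_⟩
        · simp only [Finset.mem_filter, Finset.mem_univ, true_and] at hj ⊢
          by_cases hji : j = i
          · exact hji ▸ hi
          · rwa [switch_inr_of_ne hji] at hj
        · simpa [switch_inr_self, Bool.eq_not, eq_comm] using hi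
  exact fun R hR => key _ R rfl hR

/-- Sides are chosen one partition at a time. If `j` blocks one side of `i` and `l` the other, the
chosen sides of `j` and `l` lie in opposite sides of `i`. They are disjoint, so `j` and `l` commute;
then their bases are adjacent across `i`, which is impossible. -/
theorem exists_isRegion (W : Fin k → WhiteheadPartition Γ) : ∃ R, IsRegion W R := by
  classical
  have key : ∀ J : Finset (Fin k), ∃ R : Fin k → Bool, ∀ i ∈ J, ∀ j ∈ J, i ≠ j →
      (W i).Commutes (W j) ∨ ((W i).side (R i) ∩ (W j).side (R j)).Nonempty := by
    intro J
    induction J using Finset.induction_on with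
    | empty => exact ⟨fun _ => false, by simp⟩
    | insert i J hi ih =>
      obtain ⟨R, hR⟩ := ih
      obtain ⟨b, hb⟩ : ∃ b, ∀ j ∈ J, (W i).Commutes (W j) ∨
          ((W i).side b ∩ (W j).side (R j)).Nonempty := by
        by_contra hcon
        push Not at hcon
        obtain ⟨j, hj, hj1, hj2⟩ := hcon false
        obtain ⟨l, hl, hl1, hl2⟩ := hcon true
        rw [Set.inter_comm] at hj2 hl2
        have hj3 := side_subset_of_disjoint hj2 fun h => hj1 h.symm
        have hl3 := side_subset_of_disjoint hl2 fun h => hl1 h.symm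
        have hdisj : ∀ x ∈ (W j).side (R j), x ∉ (W l).side (R l) := fun x hx hx' =>
          (W i).notMem_side_not (hl3 hx') (hj3 hx)
        have hjl : j ≠ l := by
          rintro rfl
          obtain ⟨x, hx⟩ := (W j).side_nonempty (R j)
          exact hdisj x hx hx
        rcases hR j hj l hl hjl with h | ⟨x, hx, hx'⟩
        · obtain ⟨m, hm⟩ := (W j).exists_pair
          obtain ⟨n, hn⟩ := (W l).exists_pair
          obtain ⟨s, hs⟩ := (W j).exists_mem_side_of_single ((W j).base_mem_single hm) (R j)
          obtain ⟨t, ht⟩ := (W l).exists_mem_side_of_single ((W l).base_mem_single hn) (R l)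
          have hrefl : ∀ v : V, VertexEquiv Γ v v := fun v =>
            ⟨Set.subset_insert _ _, Set.subset_insert _ _⟩
          exact (W i).not_adj_of_mem_sides (hl3 ht) (hj3 hs)
            (h m.1 ⟨m, hm, m.2, hm.mem, hm.inv_notMem, hrefl _⟩ n.1
              ⟨n, hn, n.2, hn.mem, hn.inv_notMem, hrefl _⟩).symm
        · exact hdisj x hx hx'
      refine ⟨Function.update R i b, ?_⟩
      have hne : ∀ j ∈ J, j ≠ i := by
        rintro j hj rfl
        exact hi hj
      intro r hr s hs hrs
      by_cases hri : r = i
      · subst hri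
        have hs' := (Finset.mem_insert.1 hs).resolve_left hrs.symm
        simpa [Function.update_of_ne (hne s hs')] using hb s hs'
      · by_cases hsi : s = i
        · subst hsi
          replace hr := (Finset.mem_insert.1 hr).resolve_left hri
          rw [Function.update_of_ne (hne r hr), Function.update_self, Set.inter_comm]
          exact (hb r hr).imp_left Commutes.symm
        · rw [Function.update_of_ne hri, Function.update_of_ne hsi]
          exact hR r ((Finset.mem_insert.1 hr).resolve_left hri) s
            ((Finset.mem_insert.1 hs).resolve_left hsi) hrs
  obtain ⟨R, hR⟩ := key Finset.univ
  exact ⟨R, fun i j => hR i (Finset.mem_univ _) j (Finset.mem_univ _)⟩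

/-! ### The edges at a vertex -/

variable (W) in
/-- An edge with the given label starts (`δ = false`) or ends (`δ = true`) at `x_R`. -/
def EdgeAt (R : Fin k → Bool) : V ⊕ Fin k → Bool → Prop
  | Sum.inl v, δ => (v, δ) ∈ inside W R
  | Sum.inr i, δ => R i = δ ∧ IsRegion W (switch W (Sum.inr i) R)

theorem starts_iff {R : Fin k → Bool} {a : V ⊕ Fin k} : Starts W R a ↔ EdgeAt W R a false := by
  cases a <;> rfl

theorem EdgeAt.switch_self {R : Fin k → Bool} (hR : IsRegion W R) {a : V ⊕ Fin k} {δ : Bool}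
    (h : EdgeAt W R a δ) : EdgeAt W (switch W a R) a (!δ) := by
  cases a with
  | inl v =>
    intro i
    refine (h i).imp_left fun h1 => ?_
    by_cases hs : v ∈ (W i).single
    · simpa [switch, Switches, hs] using (W i).inv_mem_side_of_single hs h1
    · simpa [switch, Switches, hs] using (W i).inv_mem_side_of_not_single' hs h1
  | inr i =>
    refine ⟨by rw [switch_inr_self, h.1], ?_⟩
    rwa [WhiteheadPartition.switch_self]

/-- After crossing `e_v`, the element `(v, !δ)` lies in every chosen side whose partition does not
have `v` in its link, so these sides meet pairwise. If `v` is in one link and a singleton of the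
other partition, the two commute. -/
theorem EdgeAt.isRegion_switch {R : Fin k → Bool} (hR : IsRegion W R) {a : V ⊕ Fin k} {δ : Bool}
    (h : EdgeAt W R a δ) : IsRegion W (switch W a R) := by
  cases a with
  | inr i => exact h.2
  | inl v =>
    have h' := h.switch_self hR
    intro i j hij
    by_cases hi : v ∈ (W i).lk
    · by_cases hj : v ∈ (W j).single
      · exact Or.inl (commutes_of_single_of_mem_lk _ _ hj hi).symm
      · have h1 : v ∉ (W i).single := fun h => (W i).notMem_lk_of_single h hi
        simpa [switch, Switches, hj, h1] using hR i j hij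
    · by_cases hj : v ∈ (W j).lk
      · by_cases hi' : v ∈ (W i).single
        · exact Or.inl (commutes_of_single_of_mem_lk _ _ hi' hj)
        · have h1 : v ∉ (W j).single := fun h => (W j).notMem_lk_of_single h hj
          simpa [switch, Switches, hi', h1] using hR i j hij
      · exact Or.inr ⟨(v, !δ), (h' i).resolve_right hi, (h' j).resolve_right hj⟩

/-- Completes a corner to a square whatever the directions of its two edges, whereas `starts_switch`
needs both to be outgoing. -/
theorem EdgeAt.switch {R : Fin k → Bool} {a b : V ⊕ Fin k} {δ ε : Bool}
    (ha : EdgeAt W R a δ) (hb : EdgeAt W R b ε) (hab : CommutingLabels W a b) :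
    EdgeAt W (switch W a R) b ε := by
  have inl_inr : ∀ (v : V) (i : Fin k) (δ : Bool), v ∈ (W i).lk → (v, δ) ∈ inside W R →
      (v, δ) ∈ inside W (WhiteheadPartition.switch W (Sum.inr i) R) := by
    intro v i δ h hv j
    by_cases hj : j = i
    · subst hj
      exact Or.inr h
    · rw [switch_inr_of_ne hj]
      exact hv j
  cases a with
  | inl v =>
    cases b with
    | inl w =>
      intro i
      by_cases hs : v ∈ (W i).single
      · exact Or.inr ((W i).mem_lk_of_adj_single hs hab)
      · simpa [WhiteheadPartition.switch, Switches, hs] using hb i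
    | inr i =>
      have hs : v ∉ (W i).single := fun h => (W i).notMem_lk_of_single h hab
      refine ⟨by simpa [WhiteheadPartition.switch, Switches, hs] using hb.1, ?_⟩
      rw [switch_switch]
      exact EdgeAt.isRegion_switch (a := Sum.inl v) (δ := δ) hb.2 (inl_inr v i δ hab ha)
  | inr i =>
    cases b with
    | inl w => exact inl_inr w i ε hab hb
    | inr j =>
      have hij : i ≠ j := hab.1
      refine ⟨by rw [switch_inr_of_ne hij.symm]; exact hb.1, ?_⟩
      refine isRegion_switch_inr ha.2 fun r hr => ?_
      rw [switch_inr_of_ne hij.symm]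
      by_cases hri : r = i
      · subst hri
        exact Or.inl hab.2.symm
      · rw [switch_inr_of_ne hri]
        simpa [switch_inr_self, switch_inr_of_ne hr] using hb.2 j r hr.symm

/-- For `e_v`: if `v` were not in the link of `j`, then `v⁻¹` would lie in both sides of `j`. For a
partition `i`: the two ends of the two edges realize all four combinations of sides of `i` and `j`,
so no two of these are disjoint, and compatibility leaves only commutation. -/
theorem commutingLabels_of_starts (hW : IsCompatibleSet W) {R R' : Fin k → Bool}
    (hR : IsRegion W R) (hR' : IsRegion W R') {a : V ⊕ Fin k} (h : Starts W R a)
    (h' : Starts W R' a) {j : Fin k} (hj : R j ≠ R' j) : CommutingLabels W a (Sum.inr j) := by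
  cases a with
  | inl v =>
    by_contra hlk
    have h1 := (h j).resolve_right hlk
    have h2 := (h' j).resolve_right hlk
    rw [(Bool.eq_not.2 hj.symm : R' j = !R j)] at h2
    exact (W j).notMem_side_not h1 h2
  | inr i =>
    have hij : i ≠ j := by
      rintro rfl
      exact hj (h.1.trans h'.1.symm)
    refine ⟨hij, by_contra fun hc => ?_⟩
    obtain ⟨b, c, hbc⟩ := (hW.compatible i j hij).resolve_left hc
    have key : ∀ S : Fin k → Bool, IsRegion W S → Starts W S (Sum.inr i) →
        ((W i).side b ∩ (W j).side (S j)).Nonempty := by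
      intro S hS hSi
      rcases Bool.eq_or_eq_not b (S i) with hb | hb
      · rw [hb]
        exact (hS i j hij).resolve_left hc
      · have := (hSi.2 i j hij).resolve_left hc
        rwa [switch_inr_self, switch_inr_of_ne hij.symm, ← hb] at this
    rcases Bool.eq_or_eq_not c (R j) with hcj | hcj
    · exact (hcj ▸ key R hR h).ne_empty hbc
    · rw [← (Bool.eq_not.2 hj.symm : R' j = !R j)] at hcj
      exact (hcj ▸ key R' hR' h').ne_empty hbc

theorem CommutingLabels.symm {a b : V ⊕ Fin k} (h : CommutingLabels W a b) :
    CommutingLabels W b a := by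
  rcases a with v | i <;> rcases b with w | j
  · exact SimpleGraph.Adj.symm h
  · exact h
  · exact h
  · exact ⟨h.1.symm, h.2.symm⟩

theorem not_commutingLabels_self (a : V ⊕ Fin k) : ¬ CommutingLabels W a a := by
  rcases a with v | i
  · exact Γ.irrefl
  · exact fun h => h.1 rfl

theorem BlowupCell.ext_of {c d : BlowupCell W} (h1 : c.region = d.region)
    (h2 : c.labels = d.labels) : c = d := by
  cases c
  cases d
  simp only at h1 h2
  subst h1 h2
  rfl

end RegionPaths

/-! ### Edge paths and hyperplanes of the blowup -/

section Paths

variable {V : Type u} [DecidableEq V] {Γ : SimpleGraph V} {k : ℕ}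
  {W : Fin k → WhiteheadPartition Γ}

/-- The edge with label `a` starting at `x_R`. -/
def blowupEdge (R : Fin k → Bool) (hR : IsRegion W R) (a : V ⊕ Fin k) (ha : Starts W R a) :
    (blowup W).Edge where
  cell :=
    { region := R
      labels := {a}
      isRegion := hR
      starts := by simpa using ha
      commuting := by simp }
  label := a
  dir_cell := rfl

theorem endpoint_blowupEdge {R : Fin k → Bool} (hR : IsRegion W R) {a : V ⊕ Fin k}
    (ha : Starts W R a) (ε : Bool) :
    (blowupEdge R hR a ha).endpoint ε = blowupVertex W (if ε then switch W a R else R)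
      (by cases ε; exacts [hR, isRegion_switch hR ha]) := by
  simp [LabelledCubeComplex.Edge.endpoint, blowup, BlowupCell.face, blowupEdge, blowupVertex]

theorem joinedByPathLabelledIn_blowupVertex [Finite V] (hW : IsCompatibleSet W)
    {R R' : Fin k → Bool} (hR : IsRegion W R) (hR' : IsRegion W R') :
    (blowup W).JoinedByPathLabelledIn {l | ∃ i : Fin k, l = Sum.inr i ∧ R i ≠ R' i}
      (blowupVertex W R hR) (blowupVertex W R' hR') := by
  refine ⟨rfl, rfl, ?_⟩
  refine region_induction hW hR' (motive := fun S => (∀ i, S i ≠ R' i → R i ≠ R' i) →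
    ∀ hS, Relation.ReflTransGen _ (blowupVertex W S hS) (blowupVertex W R' hR')) ?_ ?_ R hR
    (fun _ => id) hR
  · exact fun _ _ => Relation.ReflTransGen.refl
  · intro S _ i hi hS' ih hsub hS
    refine Relation.ReflTransGen.head ?_ (ih (fun j hj => hsub j ?_) hS')
    · cases hSi : S i
      · have hst : Starts W S (Sum.inr i) := ⟨hSi, hS'⟩
        exact ⟨blowupEdge S hS _ hst, false, ⟨i, rfl, hsub i hi⟩, endpoint_blowupEdge _ _ _,
          endpoint_blowupEdge _ _ _⟩
      -- The edge is directed from `P_i` to `P_i*`, so here it starts at the switched region and is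
      -- traversed backwards.
      · have hst : Starts W (switch W (Sum.inr i) S) (Sum.inr i) :=
          ⟨by rw [switch_inr_self, hSi]; rfl, by rwa [switch_self]⟩
        refine ⟨blowupEdge _ hS' _ hst, true, ⟨i, rfl, hsub i hi⟩, ?_, endpoint_blowupEdge _ _ _⟩
        rw [endpoint_blowupEdge]
        simp [switch_self]
    · by_cases hji : j = i
      · exact hji ▸ hi
      · rwa [switch_inr_of_ne hji] at hj

theorem edge_ext {e f : (blowup W).Edge} (hl : e.label = f.label)
    (hR : BlowupCell.region e.cell = BlowupCell.region f.cell) : e = f := by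
  obtain ⟨c, l, hc⟩ := e
  obtain ⟨d, l', hd⟩ := f
  obtain rfl : l = l' := hl
  obtain rfl : c = d := BlowupCell.ext_of hR (hc.trans hd.symm)
  rfl

theorem starts_of_edge (e : (blowup W).Edge) :
    Starts W (BlowupCell.region e.cell) e.label :=
  BlowupCell.starts e.cell _ (by
    rw [show BlowupCell.labels e.cell = {e.label} from e.dir_cell]
    exact Finset.mem_singleton_self _)

/-- The square is based at the start of `e`; `hi` ensures that the edge of the `i`-th partition is
outgoing there. -/
theorem opposite_of_switch {e f : (blowup W).Edge} {a : V ⊕ Fin k} {i : Fin k}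
    (he : e.label = a) (hf : f.label = a) (hc : CommutingLabels W a (Sum.inr i))
    (hi : BlowupCell.region e.cell i = false)
    (hef : BlowupCell.region f.cell = switch W (Sum.inr i) (BlowupCell.region e.cell)) :
    e.Opposite f := by
  have hne : a ≠ Sum.inr i := by
    rintro rfl
    exact not_commutingLabels_self _ hc
  have hs := starts_of_edge e
  rw [he] at hs
  have hR' := BlowupCell.isRegion f.cell
  rw [hef] at hR'
  have he' : BlowupCell.labels e.cell = {a} := he ▸ e.dir_cell
  have hf' : BlowupCell.labels f.cell = {a} := hf ▸ f.dir_cell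
  let c : BlowupCell W :=
    { region := BlowupCell.region e.cell
      labels := {a, Sum.inr i}
      isRegion := BlowupCell.isRegion e.cell
      starts := by
        intro b hb
        rcases Finset.mem_insert.1 hb with rfl | hb
        · exact hs
        · rw [Finset.mem_singleton.1 hb]
          exact ⟨hi, hR'⟩
      commuting := by
        intro b hb d hd hbd
        simp only [Finset.mem_insert, Finset.mem_singleton] at hb hd
        rcases hb with rfl | rfl <;> rcases hd with rfl | rfl
        · exact absurd rfl hbd
        · exact hc
        · exact hc.symm
        · exact absurd rfl hbd }
  have herase : ({a, Sum.inr i} : Finset (V ⊕ Fin k)).erase (Sum.inr i) = {a} := by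
    ext b
    simp only [Finset.mem_erase, Finset.mem_insert, Finset.mem_singleton]
    constructor
    · exact fun h => h.2.resolve_right h.1
    · rintro rfl
      exact ⟨hne, Or.inl rfl⟩
  refine ⟨c, a, Sum.inr i, by simp [blowup, c], hne, rfl, ?_, ?_⟩
  · exact BlowupCell.ext_of rfl (he'.trans herase.symm)
  · exact BlowupCell.ext_of hef (hf'.trans herase.symm)

/-- The edge `e` is slid along the path of regions towards the start of `f`. Each partition crossed
commutes with the label, so each step sweeps out a square. -/
theorem edge_mk_eq_of_label_eq [Finite V] (hW : IsCompatibleSet W) (e f : (blowup W).Edge)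
    (h : e.label = f.label) :
    Quot.mk (LabelledCubeComplex.Edge.Opposite (X := blowup W)) e = Quot.mk _ f := by
  have hf := BlowupCell.isRegion f.cell
  refine region_induction hW hf (motive := fun S => ∀ e : (blowup W).Edge, e.label = f.label →
    BlowupCell.region e.cell = S → Quot.mk LabelledCubeComplex.Edge.Opposite e = Quot.mk _ f)
    ?_ ?_ (BlowupCell.region e.cell) (BlowupCell.isRegion e.cell) e h rfl
  · rintro e he heS
    rw [edge_ext he heS]
  · rintro S hS i hi hS' ih e he rfl
    have hc := commutingLabels_of_starts hW hS hf (he ▸ starts_of_edge e) (starts_of_edge f) hi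
    have hst := starts_iff.2 (EdgeAt.switch (a := Sum.inr i) ⟨rfl, hS'⟩
      (starts_iff.1 (starts_of_edge e)) (he ▸ hc.symm))
    rw [← ih (blowupEdge _ hS' _ hst) he rfl]
    cases hb : BlowupCell.region e.cell i
    · exact Quot.sound (opposite_of_switch (e := e) (f := blowupEdge _ hS' _ hst) rfl rfl (he ▸ hc) hb rfl)
    · refine (Quot.sound (opposite_of_switch (e := blowupEdge _ hS' _ hst) (f := e) rfl rfl (he ▸ hc) ?_ ?_)).symm
      · change switch W (Sum.inr i) (BlowupCell.region e.cell) i = false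
        rw [switch_inr_self, hb]
        rfl
      · change _ = switch W (Sum.inr i) (switch W (Sum.inr i) (BlowupCell.region e.cell))
        rw [switch_self]

end Paths

end WhiteheadPartition

namespace WhiteheadPartition

/-! ## The vertex charts of the blowup -/

section Corners

variable {V : Type u} {Γ : SimpleGraph V} {k : ℕ} (W : Fin k → WhiteheadPartition Γ)

instance : Std.Commutative xor := ⟨Bool.xor_comm⟩

instance : Std.Associative xor := ⟨Bool.xor_assoc⟩

open Classical in
/-- The choice of sides at the other end of a path with the set `A` of labels. -/
noncomputable def switchAll (A : Finset (V ⊕ Fin k)) (R : Fin k → Bool) : Fin k → Bool :=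
  fun i => A.fold xor (R i) fun a => decide (Switches W a i)

variable {W}

@[simp] theorem switchAll_empty (R : Fin k → Bool) : switchAll W ∅ R = R := rfl

theorem switchAll_insert [DecidableEq V] {A : Finset (V ⊕ Fin k)} {a : V ⊕ Fin k} (ha : a ∉ A)
    (R : Fin k → Bool) : switchAll W (insert a A) R = switch W a (switchAll W A R) := by
  funext i
  simp only [switchAll, switch]
  rw [Finset.fold_insert ha]
  split_ifs with h <;> simp [h]

theorem switchAll_switch [DecidableEq V] (A : Finset (V ⊕ Fin k)) (a : V ⊕ Fin k)
    (R : Fin k → Bool) : switchAll W A (switch W a R) = switch W a (switchAll W A R) := by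
  induction A using Finset.induction_on with
  | empty => rfl
  | insert b A hb ih => rw [switchAll_insert hb, ih, switchAll_insert hb, switch_switch]

theorem switchAll_erase [DecidableEq V] {A : Finset (V ⊕ Fin k)} {a : V ⊕ Fin k} (ha : a ∈ A)
    (R : Fin k → Bool) : switchAll W (A.erase a) (switch W a R) = switchAll W A R := by
  rw [switchAll_switch, ← switchAll_insert (Finset.notMem_erase a A), Finset.insert_erase ha]

theorem switchAll_switchAll [DecidableEq V] (A : Finset (V ⊕ Fin k)) (R : Fin k → Bool) :
    switchAll W A (switchAll W A R) = R := by
  induction A using Finset.induction_on with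
  | empty => rfl
  | insert b A hb ih =>
    rw [switchAll_insert hb, switchAll_insert hb, switchAll_switch, ih, switch_self]

/-- After travelling along `A`, the edges with labels in `A` are seen from their other ends and the
remaining ones as before, hence the `xor`. This moves between any corner of a cube and the corner
where all its edges start. -/
theorem edgeAt_switchAll [DecidableEq V] {R : Fin k → Bool} (hR : IsRegion W R)
    {A B : Finset (V ⊕ Fin k)} (hAB : A ⊆ B)
    (hB : ∀ a ∈ B, ∀ b ∈ B, a ≠ b → CommutingLabels W a b) {σ : V ⊕ Fin k → Bool}
    (hσ : ∀ a ∈ B, EdgeAt W R a (σ a)) :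
    IsRegion W (switchAll W A R) ∧
      ∀ a ∈ B, EdgeAt W (switchAll W A R) a (xor (σ a) (decide (a ∈ A))) := by
  induction A using Finset.induction_on with
  | empty => exact ⟨hR, by simpa using hσ⟩
  | insert b A hb ih =>
    obtain ⟨h1, h2⟩ := ih ((Finset.subset_insert _ _).trans hAB)
    have hbB : b ∈ B := hAB (Finset.mem_insert_self _ _)
    have h3 := h2 b hbB
    rw [switchAll_insert hb]
    refine ⟨h3.isRegion_switch h1, fun a ha => ?_⟩
    by_cases hab : a = b
    · subst hab
      simpa [hb] using h3.switch_self h1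
    · simpa [hab] using h3.switch (h2 a ha) (hB b hbB a ha (Ne.symm hab))

variable (W) in
/-- Half-edges span a corner of a square if their labels commute. -/
def HalfAdj (h h' : (V ⊕ Fin k) × Bool) : Prop := CommutingLabels W h.1 h'.1

variable (W) in
/-- The half-edges at the vertex `x_R`. -/
def halfEdges (R : Fin k → Bool) : Set ((V ⊕ Fin k) × Bool) := {h | EdgeAt W R h.1 h.2}

variable [DecidableEq V]

/-- The coordinates, in the orthants at the corner of a cube at which the coordinates in `A`
are `1` and the others are `0`, of the point `t` of the cube. -/
noncomputable def cornerCoords (A : Finset (V ⊕ Fin k)) (t : EuclideanSpace ℝ (V ⊕ Fin k)) :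
    EuclideanSpace ℝ ((V ⊕ Fin k) × Bool) :=
  WithLp.toLp 2 fun h => if h.1 ∈ A then (if h.2 then 1 - t h.1 else 0)
    else (if h.2 then 0 else t h.1)

theorem cornerCoords_apply (A : Finset (V ⊕ Fin k)) (t : EuclideanSpace ℝ (V ⊕ Fin k))
    (h : (V ⊕ Fin k) × Bool) : cornerCoords A t h =
      if h.1 ∈ A then (if h.2 then 1 - t h.1 else 0) else (if h.2 then 0 else t h.1) := rfl

theorem halfAdj_of_mem_labels (c : BlowupCell W) (A : Finset (V ⊕ Fin k))
    {h h' : (V ⊕ Fin k) × Bool} (hne : h ≠ h') (h1 : h.1 ∈ c.labels ∧ h.2 = decide (h.1 ∈ A))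
    (h2 : h'.1 ∈ c.labels ∧ h'.2 = decide (h'.1 ∈ A)) : HalfAdj W h h' := by
  refine c.commuting _ h1.1 _ h2.1 fun h3 => hne (Prod.ext h3 ?_)
  rw [h1.2, h2.2, h3]

end Corners

/-! ### Lifting points, strings and chains to the chart at a vertex -/

section Charts

variable {V : Type u} [DecidableEq V] [Fintype V] {Γ : SimpleGraph V} {k : ℕ}
  {W : Fin k → WhiteheadPartition Γ}

open LabelledCubeComplex OrthantSpace

theorem dist_cornerCoords (A : Finset (V ⊕ Fin k)) (s t : EuclideanSpace ℝ (V ⊕ Fin k)) :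
    dist (cornerCoords A s) (cornerCoords A t) = dist s t := by
  rw [EuclideanSpace.dist_eq, EuclideanSpace.dist_eq, Fintype.sum_prod_type]
  congr 1
  refine Finset.sum_congr rfl fun a _ => ?_
  by_cases ha : a ∈ A
  · simp only [cornerCoords_apply, ha, Fintype.sum_bool, if_true]
    rw [Real.dist_eq, Real.dist_eq, sub_sub_sub_cancel_left, abs_sub_comm]
    simp [Real.dist_eq]
  · simp [cornerCoords_apply, ha]

/-- The point of the blowup given by the coordinates `u.2` in the cube `u.1` is the one with
coordinates `x` in the chart at `x_R`. -/
def Represents (R : Fin k → Bool) (x : OrthantSpace (HalfAdj W))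
    (u : Σ c : (blowup W).Cell, Cube ((blowup W).dir c)) : Prop :=
  ∃ A ⊆ BlowupCell.labels u.1, switchAll W A (BlowupCell.region u.1) = R ∧
    x.coords = cornerCoords A u.2.1

/-- A corner of a face is a corner of the cube: `A` is kept on the face `a = 0` and gains `a` on the
face `a = 1`. -/
theorem Represents.of_face {R : Fin k → Bool} {x : OrthantSpace (HalfAdj W)}
    (c : (blowup W).Cell) (a : V ⊕ Fin k) (ha : a ∈ (blowup W).dir c) (ε : Bool)
    (t : Cube ((blowup W).dir ((blowup W).face c a ha ε)))
    (h : Represents R x ⟨(blowup W).face c a ha ε, t⟩) :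
    Represents R x ⟨c, Cube.incl a ha ((blowup W).dir_face c a ha ε) ε t⟩ := by
  obtain ⟨A, hA, hR, hx⟩ := h
  have hA' : A ⊆ (BlowupCell.labels c).erase a := hA
  have haA : a ∉ A := fun h => Finset.notMem_erase a _ (hA' h)
  have hta : t.1 a = 0 := t.2.2 a (Finset.notMem_erase a _)
  have hac : a ∈ BlowupCell.labels c := ha
  cases ε
  · refine ⟨A, hA'.trans (Finset.erase_subset _ _), hR, ?_⟩
    rw [hx]
    ext ⟨b, δ⟩
    simp only [cornerCoords_apply, Cube.incl]
    by_cases hb : b = a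
    · subst hb
      simp [haA, hta]
    · simp [hb]
  · refine ⟨insert a A, ?_, ?_, ?_⟩
    · exact Finset.insert_subset hac (hA'.trans (Finset.erase_subset _ _))
    · rw [switchAll_insert haA, ← switchAll_switch]
      exact hR
    · rw [hx]
      ext ⟨b, δ⟩
      simp only [cornerCoords_apply, Cube.incl]
      by_cases hb : b = a
      · subst hb
        simp [haA, hta]
      · simp [hb]

/-- The corner has to lie on the given face: seen from the opposite face, the point would have
coordinate 1 at a half-edge with label `a`, which `hx1` excludes. -/
theorem Represents.face {R : Fin k → Bool} {x : OrthantSpace (HalfAdj W)}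
    (hx1 : ∀ h, x.coords h < 1)
    (c : (blowup W).Cell) (a : V ⊕ Fin k) (ha : a ∈ (blowup W).dir c) (ε : Bool)
    (t : Cube ((blowup W).dir ((blowup W).face c a ha ε)))
    (h : Represents R x ⟨c, Cube.incl a ha ((blowup W).dir_face c a ha ε) ε t⟩) :
    Represents R x ⟨(blowup W).face c a ha ε, t⟩ := by
  obtain ⟨A, hA, hR, hx⟩ := h
  have hta : t.1 a = 0 := t.2.2 a (Finset.notMem_erase a _)
  have hx0 := hx1 (a, false)
  have hx1' := hx1 (a, true)
  rw [hx, cornerCoords_apply] at hx0 hx1'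
  have hcoord : ∀ b δ, b ≠ a → cornerCoords A (Cube.incl a ha
      ((blowup W).dir_face c a ha ε) ε t).1 (b, δ) = cornerCoords (A.erase a) t.1 (b, δ) := by
    intro b δ hb
    simp [cornerCoords_apply, Cube.incl, hb]
  cases ε
  · have haA : a ∉ A := by
      intro h
      simp [h, Cube.incl] at hx1'
    refine ⟨A.erase a, Finset.erase_subset_erase _ hA, ?_, ?_⟩
    · rw [Finset.erase_eq_of_notMem haA]
      exact hR
    · rw [hx]
      ext ⟨b, δ⟩
      by_cases hb : b = a
      · subst hb
        simp [cornerCoords_apply, Cube.incl, haA, hta]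
      · exact hcoord b δ hb
  · have haA : a ∈ A := by
      by_contra h
      simp [h, Cube.incl] at hx0
    refine ⟨A.erase a, Finset.erase_subset_erase _ hA, ?_, ?_⟩
    · exact (switchAll_erase haA _).trans hR
    · rw [hx]
      ext ⟨b, δ⟩
      by_cases hb : b = a
      · subst hb
        simp [cornerCoords_apply, Cube.incl, haA, hta]
      · exact hcoord b δ hb

/-- The point `q` of the blowup is the one with coordinates `x` in the chart at `x_R`. -/
def IsLift (R : Fin k → Bool) (x : OrthantSpace (HalfAdj W)) (q : (blowup W).Realization) : Prop :=
  ∃ u, Quot.mk _ u = q ∧ Represents R x u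

/-- For coordinates below 1, `Represents` is invariant under gluing, so it descends to the
realization and can be tested in any cube containing the point. -/
theorem IsLift.represents {R : Fin k → Bool} {x : OrthantSpace (HalfAdj W)}
    (hx1 : ∀ h, x.coords h < 1) {c : (blowup W).Cell} {s : Cube ((blowup W).dir c)}
    (h : IsLift R x ((blowup W).charMap c s)) : Represents R x ⟨c, s⟩ := by
  obtain ⟨u, hu, hu'⟩ := h
  let P : (blowup W).Realization → Prop := Quot.lift (Represents R x) (by
    rintro _ _ ⟨c, a, ha, ε, t⟩
    exact propext ⟨.of_face c a ha ε t, .face hx1 c a ha ε t⟩)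
  have h1 : P (Quot.mk _ u) := hu'
  rw [hu] at h1
  exact h1

theorem exists_incl_eq {A B : Finset (V ⊕ Fin k)} {a : V ⊕ Fin k} (ha : a ∈ A)
    (hB : B = A.erase a) {ε : Bool} (s : Cube A) (hs : s.1 a = if ε then 1 else 0) :
    ∃ t : Cube B, s = Cube.incl a ha hB ε t := by
  subst hB
  refine ⟨⟨WithLp.toLp 2 (Function.update (fun b => s.1 b) a 0), fun b hb => ?_, fun b hb => ?_⟩, ?_⟩
  · have hb' := Finset.mem_erase.1 hb
    simpa [hb'.1] using s.2.1 b hb'.2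
  · by_cases hba : b = a
    · simp [hba]
    · simpa [hba] using s.2.2 b fun h => hb (Finset.mem_erase.2 ⟨hba, h⟩)
  · refine Subtype.ext ?_
    ext b
    by_cases hba : b = a
    · subst hba
      simp [Cube.incl, hs]
    · simp [Cube.incl, hba]

/-- A point with given coordinates in a chart lies in the interior of a cube. -/
theorem IsLift.exists_minimal {R : Fin k → Bool} {x : OrthantSpace (HalfAdj W)}
    (hx1 : ∀ h, x.coords h < 1) {q : (blowup W).Realization} (h : IsLift R x q) :
    ∃ u, Quot.mk _ u = q ∧ Represents R x u ∧
      ∀ a ∈ BlowupCell.labels u.1, x.coords (a, false) ≠ 0 ∨ x.coords (a, true) ≠ 0 := by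
  obtain ⟨u, hu, hu'⟩ := h
  obtain ⟨n, hn⟩ : ∃ n, (BlowupCell.labels u.1).card = n := ⟨_, rfl⟩
  induction n using Nat.strong_induction_on generalizing u with
  | _ n ih =>
    by_cases hall : ∀ a ∈ BlowupCell.labels u.1, x.coords (a, false) ≠ 0 ∨ x.coords (a, true) ≠ 0
    · exact ⟨u, hu, hu', hall⟩
    · push Not at hall
      obtain ⟨a, ha, h0, h1⟩ := hall
      obtain ⟨c, s⟩ := u
      -- Both half-edge coordinates of `a` vanish, so the point lies on the face of the cube
      -- containing the corner `A`.
      have hs : ∃ ε : Bool, s.1 a = if ε then 1 else 0 := by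
        obtain ⟨A, hA, hR, hx⟩ := hu'
        rw [hx, cornerCoords_apply] at h0 h1
        by_cases haA : a ∈ A
        · exact ⟨true, by simp only [haA, if_true] at h1 ⊢; linarith⟩
        · exact ⟨false, by simpa [haA] using h0⟩
      obtain ⟨ε, hε⟩ := hs
      obtain ⟨t, ht⟩ := exists_incl_eq ha ((blowup W).dir_face c a ha ε) s hε
      rw [ht] at hu hu'
      refine ih _ ?_ ⟨(blowup W).face c a ha ε, t⟩ ?_ (hu'.face hx1) rfl
      · rw [← hn]
        exact Finset.card_lt_card (Finset.erase_ssubset ha)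
      · rw [← hu]
        exact Quot.sound (.face c a ha ε t)

/-- In a minimal cube everything can be read off from `x`: the labels from its support, the corner
`A` from the nonzero `(a, true)` coordinates, and the region by undoing `A` from `R`. -/
theorem IsLift.unique {R : Fin k → Bool} {x : OrthantSpace (HalfAdj W)}
    (hx1 : ∀ h, x.coords h < 1) {q q' : (blowup W).Realization} (h : IsLift R x q)
    (h' : IsLift R x q') : q = q' := by
  obtain ⟨⟨c, s⟩, rfl, ⟨A, hA, hR, hx⟩, hmin⟩ := h.exists_minimal hx1
  obtain ⟨⟨c', s'⟩, rfl, ⟨A', hA', hR', hx'⟩, hmin'⟩ := h'.exists_minimal hx1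
  have hAmem : ∀ {c : BlowupCell W} {s : Cube ((blowup W).dir c)} {A : Finset (V ⊕ Fin k)},
      A ⊆ c.labels → x.coords = cornerCoords A s.1 →
      (∀ a ∈ c.labels, x.coords (a, false) ≠ 0 ∨ x.coords (a, true) ≠ 0) →
      ∀ a, (a ∈ A ↔ x.coords (a, true) ≠ 0) ∧
        (a ∈ c.labels ↔ x.coords (a, false) ≠ 0 ∨ x.coords (a, true) ≠ 0) := by
    intro c s A hA hx hmin a
    have h1 : a ∈ A → x.coords (a, false) = 0 := fun h => by
      simp [hx, cornerCoords_apply, h]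
    have h2 : a ∉ A → x.coords (a, true) = 0 := fun h => by
      simp [hx, cornerCoords_apply, h]
    refine ⟨⟨fun h => (hmin a (hA h)).resolve_left fun h3 => h3 (h1 h),
      fun h => by_contra fun h3 => h (h2 h3)⟩, hmin a, fun h => ?_⟩
    by_contra hac
    have haA : a ∉ A := fun h => hac (hA h)
    refine h.elim (fun h3 => h3 ?_) fun h3 => h3 (h2 haA)
    simpa [hx, cornerCoords_apply, haA] using s.2.2 a hac
  have m1 := hAmem hA hx hmin
  have m2 := hAmem hA' hx' hmin'
  obtain rfl : A = A' := by
    ext a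
    rw [(m1 a).1, (m2 a).1]
  obtain rfl : c = c' := by
    refine BlowupCell.ext_of ?_ ?_
    · have h1 := switchAll_switchAll (W := W) A (BlowupCell.region c)
      rw [← h1, hR, ← hR']
      exact switchAll_switchAll A _
    · ext a
      exact (m1 a).2.trans (m2 a).2.symm
  congr 2
  refine Subtype.ext ?_
  ext a
  rw [hx] at hx'
  by_cases ha : a ∈ A
  · have := congrArg (fun y => y (a, true)) hx'
    simpa [cornerCoords_apply, ha] using this
  · have := congrArg (fun y => y (a, false)) hx'
    simpa [cornerCoords_apply, ha] using this

/-- Close points of a chart represent distinct points of the blowup. -/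
theorem IsLift.inj {R : Fin k → Bool} {x y : OrthantSpace (HalfAdj W)}
    (hx1 : ∀ h, x.coords h < 1) (hy1 : ∀ h, y.coords h < 1) {q : (blowup W).Realization}
    (hx : IsLift R x q) (hy : IsLift R y q) (hxy : dist x y < 1 / 2) : x = y := by
  obtain ⟨⟨c, s⟩, rfl⟩ := Quot.exists_rep q
  obtain ⟨A, hA, -, hxA⟩ := IsLift.represents hx1 hx
  obtain ⟨B, hB, -, hyB⟩ := IsLift.represents hy1 hy
  have hcoord : ∀ h, |x.coords h - y.coords h| < 1 / 2 := fun h =>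
    (abs_coords_sub_le x y h).trans_lt hxy
  -- Since edges may be loops, two corners of one cube can both be `x_R`. If they differ at `a`,
  -- then `x` and `y` see the coordinate `t` of label `a` from opposite ends, and comparing their
  -- half-edge coordinates gives both `1 - t < 1/2` and `t < 1/2`.
  obtain rfl : A = B := by
    ext a
    have h0 := hcoord (a, false)
    have h1 := hcoord (a, true)
    rw [hxA, hyB, cornerCoords_apply, cornerCoords_apply, abs_lt] at h0 h1
    by_cases ha : a ∈ A <;> by_cases hb : a ∈ B <;> simp [ha, hb] at h0 h1 ⊢
    · linarith
    · linarith
  ext h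
  rw [hxA, hyB]

theorem cornerCoords_ne_zero {A B : Finset (V ⊕ Fin k)} (hAB : A ⊆ B) (t : Cube B)
    {h : (V ⊕ Fin k) × Bool} (hh : cornerCoords A t.1 h ≠ 0) :
    h.1 ∈ B ∧ h.2 = decide (h.1 ∈ A) := by
  rw [cornerCoords_apply] at hh
  constructor
  · by_contra hc
    have := t.2.2 _ hc
    have hcA : h.1 ∉ A := fun h => hc (hAB h)
    simp [hcA, this] at hh
  · split_ifs at hh with h3 h4 h4 <;> simp_all

/-- The point of the orthants at a corner of the cube `c`. -/
noncomputable def cornerPoint (c : BlowupCell W) {A : Finset (V ⊕ Fin k)} (hA : A ⊆ c.labels)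
    (t : Cube c.labels) : OrthantSpace (HalfAdj W) where
  coords := cornerCoords A t.1
  nonneg h := by
    rw [cornerCoords_apply]
    by_cases hc : h.1 ∈ c.labels
    · have := t.2.1 _ hc
      split_ifs
      · exact sub_nonneg.2 this.2
      · exact le_rfl
      · exact le_rfl
      · exact this.1
    · have := t.2.2 _ hc
      split_ifs with h1
      · exact absurd (hA h1) hc
      · exact le_rfl
      · exact le_rfl
      · exact this.ge
  clique _ _ hne h1 h2 := halfAdj_of_mem_labels c A hne (cornerCoords_ne_zero hA t h1)
    (cornerCoords_ne_zero hA t h2)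

theorem compat_cornerPoint (c : BlowupCell W) {A : Finset (V ⊕ Fin k)} (hA : A ⊆ c.labels)
    (s t : Cube c.labels) : Compat (cornerPoint c hA s) (cornerPoint c hA t) :=
  fun _ _ hne h1 h2 => halfAdj_of_mem_labels c A hne
    (h1.elim (cornerCoords_ne_zero hA s) (cornerCoords_ne_zero hA t))
    (h2.elim (cornerCoords_ne_zero hA s) (cornerCoords_ne_zero hA t))

theorem cornerPoint_mem (c : BlowupCell W) {A : Finset (V ⊕ Fin k)} (hA : A ⊆ c.labels)
    (t : Cube c.labels) : cornerPoint c hA t ∈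
      supportedOn (HalfAdj W) (halfEdges W (switchAll W A c.region)) := by
  intro h hh
  obtain ⟨h1, h2⟩ := cornerCoords_ne_zero hA t hh
  have := (edgeAt_switchAll c.isRegion hA c.commuting (σ := fun _ => false)
    fun a ha => starts_iff.1 (c.starts a ha)).2 _ h1
  rw [Bool.false_xor, ← h2] at this
  exact this

/-- Strings in the blowup can be lifted to a chart. -/
theorem IsLift.exists_of_isStringLength {R : Fin k → Bool} {q q' : (blowup W).Realization}
    {l : ENNReal} (h : (blowup W).IsStringLength q q' l) {x : OrthantSpace (HalfAdj W)}
    (hx : IsLift R x q) (hxS : x ∈ supportedOn (HalfAdj W) (halfEdges W R))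
    (hxl : ∀ h, ENNReal.ofReal (x.coords h) + l < 1) :
    ∃ y ∈ supportedOn (HalfAdj W) (halfEdges W R), IsLift R y q' ∧ edist x y ≤ l := by
  induction h generalizing x with
  | nil q => exact ⟨x, hxS, hx, by simp⟩
  | cons c s t q' l _ ih =>
    obtain ⟨A, hA, rfl, hxA⟩ := hx.represents fun h =>
      ENNReal.ofReal_lt_one.1 (lt_of_le_of_lt le_self_add (hxl h))
    obtain rfl : x = cornerPoint c hA s := by
      ext h
      rw [hxA]
      rfl
    have hdist : edist (cornerPoint c hA s) (cornerPoint c hA t) = edist s t := by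
      rw [edist_dist, (compat_cornerPoint c hA s t).dist_eq]
      change ENNReal.ofReal (dist (cornerCoords A s.1) (cornerCoords A t.1)) = _
      rw [dist_cornerCoords, ← edist_dist]
      rfl
    obtain ⟨y, hy, hy', hyl⟩ := ih (x := cornerPoint c hA t) ⟨_, rfl, A, hA, rfl, rfl⟩
      (cornerPoint_mem c hA t) fun h => by
        refine lt_of_le_of_lt ?_ (hxl h)
        rw [← add_assoc, ← hdist, edist_dist,
          ← ENNReal.ofReal_add ((cornerPoint c hA s).nonneg h) dist_nonneg]
        gcongr
        have := abs_coords_sub_le (cornerPoint c hA s) (cornerPoint c hA t) h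
        linarith [neg_le_of_abs_le this]
    refine ⟨y, hy, hy', (edist_triangle _ (cornerPoint c hA t) _).trans ?_⟩
    rw [hdist]
    gcongr

/-- Two points of a common orthant of a chart, close to the vertex, lie in a common cube. -/
theorem exists_common_cube {R : Fin k → Bool} (hR : IsRegion W R) {x y : OrthantSpace (HalfAdj W)}
    (hxS : x ∈ supportedOn (HalfAdj W) (halfEdges W R))
    (hyS : y ∈ supportedOn (HalfAdj W) (halfEdges W R)) (hxy : Compat x y)
    (hx1 : ∀ h, x.coords h ≤ 1) (hy1 : ∀ h, y.coords h ≤ 1) :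
    ∃ (c : (blowup W).Cell) (s t : Cube ((blowup W).dir c)), dist s t = dist x.coords y.coords ∧
      Represents R x ⟨c, s⟩ ∧ Represents R y ⟨c, t⟩ := by
  classical
  set nz : (V ⊕ Fin k) × Bool → Prop := fun h => x.coords h ≠ 0 ∨ y.coords h ≠ 0 with hnz
  set B := Finset.univ.filter fun a => nz (a, false) ∨ nz (a, true) with hB
  set A := Finset.univ.filter fun a => nz (a, true) with hA
  have hAB : A ⊆ B := by
    intro a ha
    simp only [hA, hB, Finset.mem_filter, Finset.mem_univ, true_and] at ha ⊢
    exact Or.inr ha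
  have hnzS : ∀ h, nz h → EdgeAt W R h.1 h.2 := fun h hh => hh.elim (hxS h) (hyS h)
  -- The two ends of a loop span no corner, because a label does not commute with itself.
  have hA0 : ∀ a ∈ A, ¬ nz (a, false) := by
    intro a ha h0
    simp only [hA, Finset.mem_filter, Finset.mem_univ, true_and] at ha
    exact not_commutingLabels_self a (hxy (a, false) (a, true) (by simp) h0 ha)
  have hA1 : ∀ a ∉ A, ¬ nz (a, true) := fun a ha => by
    simpa only [hA, Finset.mem_filter, Finset.mem_univ, true_and] using ha
  have hBmem : ∀ a ∈ B, nz (a, decide (a ∈ A)) := by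
    intro a ha
    simp only [hB, Finset.mem_filter, Finset.mem_univ, true_and] at ha
    by_cases haA : a ∈ A
    · simpa [haA] using ha.resolve_left (hA0 a haA)
    · simpa [haA] using ha.resolve_right (hA1 a haA)
  have hBcomm : ∀ a ∈ B, ∀ b ∈ B, a ≠ b → CommutingLabels W a b := fun a ha b hb hab =>
    hxy _ _ (fun h => hab (Prod.ext_iff.1 h).1) (hBmem a ha) (hBmem b hb)
  -- This is where the link is flag: pairwise commuting edges at `x_R` span a cube. The labels in
  -- `A` are those of the edges ending at `x_R`, so travelling along `A` leads to the corner at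
  -- which all edges start.
  have hedge := edgeAt_switchAll hR hAB hBcomm (σ := fun a => decide (a ∈ A))
    fun a ha => hnzS _ (hBmem a ha)
  let c : BlowupCell W :=
    { region := switchAll W A R
      labels := B
      isRegion := hedge.1
      starts := fun a ha => starts_iff.2 (by simpa using hedge.2 a ha)
      commuting := hBcomm }
  have hcube : ∀ z : OrthantSpace (HalfAdj W), (∀ h, z.coords h ≤ 1) →
      (∀ h, z.coords h ≠ 0 → nz h) → ∃ s : Cube B, z.coords = cornerCoords A s.1 := by
    intro z hz1 hz
    refine ⟨⟨WithLp.toLp 2 fun a => if a ∈ A then 1 - z.coords (a, true) else z.coords (a, false),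
      fun a _ => ?_, fun a ha => ?_⟩, ?_⟩
    · have e1 := hz1 (a, true)
      have e2 := hz1 (a, false)
      have e3 := z.nonneg (a, true)
      have e4 := z.nonneg (a, false)
      by_cases haA : a ∈ A
      · simp only [haA, if_true]
        exact ⟨by linarith, by linarith⟩
      · simp only [haA, if_false]
        exact ⟨e4, e2⟩
    · have haA : a ∉ A := fun h => ha (hAB h)
      simp only [haA, if_false]
      by_contra h0
      refine ha ?_
      simp only [hB, Finset.mem_filter, Finset.mem_univ, true_and]
      exact Or.inl (hz _ h0)
    · ext ⟨a, δ⟩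
      rw [cornerCoords_apply]
      by_cases haA : a ∈ A <;> cases δ <;> simp only [haA, if_true, if_false]
      · exact by_contra fun h => hA0 a haA (hz _ h)
      · simp
      · simp
      · simpa using by_contra fun h => hA1 a haA (hz _ h)
  obtain ⟨s, hs⟩ := hcube x hx1 fun h hh => Or.inl hh
  obtain ⟨t, ht⟩ := hcube y hy1 fun h hh => Or.inr hh
  refine ⟨c, s, t, ?_, ⟨A, hAB, switchAll_switchAll A R, hs⟩,
    ⟨A, hAB, switchAll_switchAll A R, ht⟩⟩
  rw [hs, ht, dist_cornerCoords]
  rfl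

theorem edist_charMap_le (c : (blowup W).Cell) (s t : Cube ((blowup W).dir c)) :
    edist ((blowup W).charMap c s) ((blowup W).charMap c t) ≤ edist s t :=
  sInf_le (by simpa using IsStringLength.cons c s t _ 0 (.nil _))

/-- Chains in a chart give rise to strings in the blowup. -/
theorem IsLift.exists_of_isChain {R : Fin k → Bool} (hR : IsRegion W R)
    {x y : OrthantSpace (HalfAdj W)} {l : ℝ} (h : IsChain x y l) {q : (blowup W).Realization}
    (hx : IsLift R (x.restrict (halfEdges W R)) q) (hxl : ∀ h, x.coords h + l < 1) :
    ∃ q', IsLift R (y.restrict (halfEdges W R)) q' ∧ edist q q' ≤ ENNReal.ofReal l := by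
  induction h generalizing q with
  | nil x => exact ⟨q, hx, by simp⟩
  | cons x z y l hc hl ih =>
    have hl0 : 0 ≤ l := dist_nonneg.trans hl.le
    have hd0 : 0 ≤ dist x.coords z.coords := dist_nonneg
    have hz : ∀ h, z.coords h + l < 1 := fun h => by
      have h1 := abs_coords_sub_le x z h
      rw [hc.dist_eq] at h1
      linarith [neg_le_of_abs_le h1, hxl h]
    have hx1 : ∀ h, (x.restrict (halfEdges W R)).coords h < 1 := fun h =>
      (coords_restrict_le _ x h).trans_lt (by linarith [hxl h])
    have hz1 : ∀ h, (z.restrict (halfEdges W R)).coords h < 1 := fun h =>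
      (coords_restrict_le _ z h).trans_lt (by linarith [hz h])
    -- The chain may use half-edges that are not present at `x_R`; after projection to `halfEdges W
    -- R`, consecutive points lie in a common cube.
    obtain ⟨c, s, t, hst, hs, ht⟩ := exists_common_cube hR (restrict_mem _ x) (restrict_mem _ z)
      (hc.restrict _) (fun h => (hx1 h).le) fun h => (hz1 h).le
    obtain rfl := hx.unique hx1 ⟨_, rfl, hs⟩
    obtain ⟨q', hq', hle⟩ := ih ⟨_, rfl, ht⟩ hz
    refine ⟨q', hq', (edist_triangle _ ((blowup W).charMap c t) _).trans ?_⟩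
    rw [ENNReal.ofReal_add hd0 hl0]
    refine add_le_add ((edist_charMap_le c s t).trans ?_) hle
    rw [edist_dist, hst]
    exact ENNReal.ofReal_le_ofReal (dist_coords_restrict_le _ x z)

end Charts

end WhiteheadPartition

namespace WhiteheadPartition

/-! ### Balls of the blowup as balls of orthant spaces -/

section LocalGeometry

variable {V : Type u} [DecidableEq V] [Fintype V] {Γ : SimpleGraph V} {k : ℕ}
  {W : Fin k → WhiteheadPartition Γ}

open LabelledCubeComplex OrthantSpace

/-- Every point of the blowup is represented by a point near the vertex of some chart. -/
theorem exists_isLift (p : (blowup W).Realization) :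
    ∃ (R : Fin k → Bool) (x : OrthantSpace (HalfAdj W)), IsRegion W R ∧
      x ∈ supportedOn (HalfAdj W) (halfEdges W R) ∧ IsLift R x p ∧ ∀ h, x.coords h ≤ 1 / 2 := by
  classical
  obtain ⟨⟨c, s⟩, rfl⟩ := Quot.exists_rep p
  -- The corner of the cube nearest to the point.
  have hA : ((BlowupCell.labels c).filter fun a => 1 / 2 < s.1 a) ⊆ BlowupCell.labels c :=
    Finset.filter_subset _ _
  refine ⟨_, cornerPoint c hA s, ?_, cornerPoint_mem c hA s, ⟨_, rfl, _, hA, rfl, rfl⟩, ?_⟩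
  · exact (edgeAt_switchAll (BlowupCell.isRegion c) hA (BlowupCell.commuting c)
      (σ := fun _ => false) fun a ha => starts_iff.1 (BlowupCell.starts c a ha)).1
  · rintro ⟨a, δ⟩
    change cornerCoords _ s.1 (a, δ) ≤ 1 / 2
    rw [cornerCoords_apply]
    by_cases ha : a ∈ (BlowupCell.labels c).filter fun a => 1 / 2 < s.1 a
    · have := (Finset.mem_filter.1 ha).2
      cases δ <;> simp only [ha, if_true] <;> norm_num
      linarith
    · cases δ <;> simp only [ha, if_false] <;> norm_num
      by_cases hac : a ∈ BlowupCell.labels c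
      · by_contra hlt
        exact ha (Finset.mem_filter.2 ⟨hac, by linarith⟩)
      · rw [s.2.2 a hac]
        norm_num

/-- The ball of radius 1/8 is mapped isometrically by `log`, the inverse of the chart. Chart
coordinates there stay below 1/2 + 1/8 = 5/8, and any two values of `log` are less than 1/4 apart.
Strings shorter than 1/4 thus lift with coordinates below 7/8, and the lifted end is within 1/4 +
1/4 = 1/2 of the expected one, as `IsLift.inj` requires. -/
theorem isLocallyCAT0_blowup : IsLocallyCAT0 (blowup W).Realization := by
  classical
  intro p
  obtain ⟨R, x₀, hR, hx₀S, hx₀, hx₀1⟩ := exists_isLift p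
  set S := supportedOn (HalfAdj W) (halfEdges W R) with hS
  have coords_lt : ∀ y, dist x₀ y < 1 / 8 → ∀ h, y.coords h < 5 / 8 := fun y hy h => by
    have := abs_coords_sub_le x₀ y h
    linarith [neg_le_of_abs_le this, hx₀1 h]
  have coords_lt_one : ∀ y, dist x₀ y < 1 / 8 → ∀ h, y.coords h < 1 := fun y hy h =>
    (coords_lt y hy h).trans (by norm_num)
  have lift : ∀ x ∈ S, dist x₀ x < 1 / 8 → ∀ q, IsLift R x q → ∀ q' l, l < ENNReal.ofReal (1 / 4) →
      (blowup W).IsStringLength q q' l → ∃ y ∈ S, IsLift R y q' ∧ edist x y ≤ l := by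
    intro x hxS hx q hq q' l hl hstr
    refine hq.exists_of_isStringLength hstr hxS fun h => ?_
    calc ENNReal.ofReal (x.coords h) + l < ENNReal.ofReal (5 / 8) + ENNReal.ofReal (1 / 4) :=
          ENNReal.add_lt_add ((ENNReal.ofReal_lt_ofReal_iff (by norm_num)).2 (coords_lt x hx h)) hl
      _ = ENNReal.ofReal (7 / 8) := by
          rw [← ENNReal.ofReal_add (by norm_num) (by norm_num)]
          norm_num
      _ ≤ 1 := ENNReal.ofReal_le_one.2 (by norm_num)
  have push : ∀ x ∈ S, dist x₀ x < 1 / 8 → ∀ q, IsLift R x q → ∀ y ∈ S, ∀ r ≤ 1 / 4,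
      dist x y < r → ∃ q', IsLift R y q' ∧ edist q q' ≤ ENNReal.ofReal r := by
    intro x hxS hx q hq y hyS r hr hxy
    obtain ⟨l, hl, hchain⟩ := exists_isChain_lt hxy
    rw [← restrict_of_mem hxS] at hq
    obtain ⟨q', hq', hle⟩ := hq.exists_of_isChain hR hchain fun h => by
      linarith [coords_lt x hx h]
    rw [restrict_of_mem hyS] at hq'
    exact ⟨q', hq', hle.trans (ENNReal.ofReal_le_ofReal hl.le)⟩
  have string : ∀ {q q' : (blowup W).Realization} {r : ENNReal}, edist q q' < r →
      ∃ l < r, (blowup W).IsStringLength q q' l := by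
    intro q q' r h
    obtain ⟨l, h1, h2⟩ := sInf_lt_iff.1 (show sInf {l | (blowup W).IsStringLength q q' l} < r from h)
    exact ⟨l, h2, h1⟩
  have hlog : ∀ q : Metric.eball p (ENNReal.ofReal (1 / 8)),
      ∃ y ∈ S, IsLift R y q.1 ∧ dist x₀ y < 1 / 8 := by
    rintro ⟨q, hq⟩
    rw [Metric.mem_eball, edist_comm] at hq
    obtain ⟨l, hl, hstr⟩ := string hq
    obtain ⟨y, hyS, hy, hle⟩ := lift x₀ hx₀S (by simp) p hx₀ q l
      (hl.trans ((ENNReal.ofReal_lt_ofReal_iff (by norm_num)).2 (by norm_num))) hstr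
    refine ⟨y, hyS, hy, ?_⟩
    have := hle.trans_lt hl
    rwa [edist_dist, ENNReal.ofReal_lt_ofReal_iff (by norm_num)] at this
  choose log hlogS hloglift hlogdist using hlog
  have hloglog : ∀ q q', dist (log q) (log q') < 1 / 4 := fun q q' => by
    have h1 := dist_triangle_left (log q) (log q') x₀
    linarith [hlogdist q, hlogdist q']
  refine ⟨ENNReal.ofReal (1 / 8), by norm_num, isCAT0_of_isometry (φ := log) ?_ ?_ ?_⟩
  · intro q q'
    refine le_antisymm (le_sInf fun l hl => ?_) ?_
    · rcases lt_or_ge l (ENNReal.ofReal (1 / 4)) with hl4 | hl4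
      · obtain ⟨y, hyS, hy, hle⟩ := lift _ (hlogS q) (hlogdist q) _ (hloglift q) _ l hl4 hl
        have hlt := hle.trans_lt hl4
        rw [edist_dist, ENNReal.ofReal_lt_ofReal_iff (by norm_num)] at hlt
        have hy1 : ∀ h, y.coords h < 1 := fun h => by
          have := abs_coords_sub_le (log q) y h
          linarith [neg_le_of_abs_le this, coords_lt _ (hlogdist q) h]
        have hyq : y = log q' := by
          refine IsLift.inj hy1 (coords_lt_one _ (hlogdist q')) hy (hloglift q') ?_
          have := dist_triangle_left y (log q') (log q)
          linarith [hloglog q q']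
        exact hyq ▸ hle
      -- Longer strings cannot violate the bound, since the values of `log` are closer than 1/4.
      · refine le_trans ?_ hl4
        rw [edist_dist]
        exact ENNReal.ofReal_le_ofReal (hloglog q q').le
    · have key : ∀ r, dist (log q) (log q') < r → r ≤ 1 / 4 →
          edist q q' ≤ ENNReal.ofReal r := by
        intro r hr hr4
        obtain ⟨q'', hq'', hle⟩ := push _ (hlogS q) (hlogdist q) _ (hloglift q) _ (hlogS q') r hr4 hr
        obtain rfl := hq''.unique (coords_lt_one _ (hlogdist q')) (hloglift q')
        exact hle
      have hlim : Filter.Tendsto (fun r : ℝ => ENNReal.ofReal r)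
          (nhdsWithin (dist (log q) (log q')) (Set.Ioi (dist (log q) (log q'))))
          (nhds (ENNReal.ofReal (dist (log q) (log q')))) :=
        (ENNReal.continuous_ofReal.tendsto _).mono_left nhdsWithin_le_nhds
      rw [edist_dist]
      refine ge_of_tendsto hlim ?_
      filter_upwards [Ioo_mem_nhdsGT (hloglog q q')] with r hr using key r hr.1 hr.2.le
  · intro q q' hqq
    have h1 := hloglift q
    rw [hqq] at h1
    exact Subtype.ext (h1.unique (coords_lt_one _ (hlogdist q')) (hloglift q'))
  -- Every point of the chart ball is reached, because chains starting at `x₀` push down to strings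
  -- starting at `p`.
  · have hrange : Set.range log = S ∩ Metric.ball x₀ (1 / 8) := by
      ext y
      constructor
      · rintro ⟨q, rfl⟩
        exact ⟨hlogS q, Metric.mem_ball'.2 (hlogdist q)⟩
      · rintro ⟨hyS, hy⟩
        rw [Metric.mem_ball'] at hy
        obtain ⟨r, hr1, hr2⟩ := exists_between hy
        obtain ⟨q, hq, hle⟩ := push x₀ hx₀S (by simp) p hx₀ y hyS r (by linarith) hr1
        have hmem : q ∈ Metric.eball p (ENNReal.ofReal (1 / 8)) := by
          rw [Metric.mem_eball, edist_comm]
          exact hle.trans_lt ((ENNReal.ofReal_lt_ofReal_iff (by norm_num)).2 hr2)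
        refine ⟨⟨q, hmem⟩, ?_⟩
        refine IsLift.inj (coords_lt_one _ (hlogdist _)) (coords_lt_one _ hy) (hloglift ⟨q, hmem⟩)
          hq ?_
        have := dist_triangle_left (log ⟨q, hmem⟩) y x₀
        linarith [hlogdist ⟨q, hmem⟩]
    rw [hrange]
    refine IsStewart.inter_ball ?_ hx₀S _
    have := isStewart_supportedOn (adj := HalfAdj W) (Set.toFinite (halfEdges W R)).toFinset
    rwa [Set.Finite.coe_toFinset] at this

/-! ## Connectedness -/

/-- Unit cubes are convex and characteristic maps are 1-Lipschitz, so the image of a cube is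
connected. -/
theorem connectedComponent_charMap_eq (c : (blowup W).Cell) (s t : Cube ((blowup W).dir c)) :
    connectedComponent ((blowup W).charMap c s) = connectedComponent ((blowup W).charMap c t) := by
  have hconv : Convex ℝ {t : EuclideanSpace ℝ (V ⊕ Fin k) |
      (∀ a ∈ (blowup W).dir c, t a ∈ Set.Icc (0 : ℝ) 1) ∧ ∀ a ∉ (blowup W).dir c, t a = 0} := by
    rintro x ⟨hx, hx'⟩ y ⟨hy, hy'⟩ r r' hr hr' hrr
    refine ⟨fun a ha => ?_, fun a ha => ?_⟩
    · exact convex_Icc (0 : ℝ) 1 (hx a ha) (hy a ha) hr hr' hrr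
    · simp [hx' a ha, hy' a ha]
  have : PreconnectedSpace (Cube ((blowup W).dir c)) :=
    Subtype.preconnectedSpace hconv.isPreconnected
  have hcont : Continuous ((blowup W).charMap c) := by
    refine LipschitzWith.continuous (K := 1) fun s t => ?_
    simpa using edist_charMap_le c s t
  exact connectedComponent_eq ((isPreconnected_range hcont).subset_connectedComponent
    ⟨s, rfl⟩ ⟨t, rfl⟩)

theorem connectedComponent_face_eq (c : (blowup W).Cell) (a : V ⊕ Fin k)
    (ha : a ∈ (blowup W).dir c) (ε : Bool) (s : Cube ((blowup W).dir c))
    (t : Cube ((blowup W).dir ((blowup W).face c a ha ε))) :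
    connectedComponent ((blowup W).charMap _ t) = connectedComponent ((blowup W).charMap c s) := by
  rw [show (blowup W).charMap _ t = (blowup W).charMap c _ from Quot.sound (.face c a ha ε t)]
  exact connectedComponent_charMap_eq c _ s

/-- Passing to a face `a = 0` removes one label without leaving the component, until a vertex is
reached. -/
theorem exists_vertex_connectedComponent_eq (c : (blowup W).Cell) (s : Cube ((blowup W).dir c)) :
    ∃ (R : Fin k → Bool) (hR : IsRegion W R), ∀ t,
      connectedComponent ((blowup W).charMap c s) =
        connectedComponent ((blowup W).charMap (blowupVertex W R hR) t) := by
  obtain ⟨n, hn⟩ : ∃ n, (BlowupCell.labels c).card = n := ⟨_, rfl⟩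
  induction n generalizing c with
  | zero =>
    have hc : c = blowupVertex W (BlowupCell.region c) (BlowupCell.isRegion c) :=
      BlowupCell.ext_of rfl (Finset.card_eq_zero.1 hn)
    refine ⟨_, BlowupCell.isRegion c, ?_⟩
    rw [← hc]
    exact fun t => connectedComponent_charMap_eq c s t
  | succ n ih =>
    obtain ⟨a, ha⟩ := Finset.card_pos.1 (by rw [hn]; exact n.succ_pos :
      0 < (BlowupCell.labels c).card)
    have h0 : (0 : EuclideanSpace ℝ (V ⊕ Fin k)) ∈ {t : EuclideanSpace ℝ (V ⊕ Fin k) |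
        (∀ b ∈ (blowup W).dir ((blowup W).face c a ha false), t b ∈ Set.Icc (0 : ℝ) 1) ∧
        ∀ b ∉ (blowup W).dir ((blowup W).face c a ha false), t b = 0} := by simp
    obtain ⟨R, hR, h⟩ := ih ((blowup W).face c a ha false) ⟨0, h0⟩ (by
      have := Finset.card_erase_of_mem ha
      rw [hn] at this
      exact this)
    exact ⟨R, hR, fun t => (connectedComponent_face_eq c a ha false s _).symm.trans (h t)⟩

theorem connectedSpace_blowup (hW : IsCompatibleSet W) :
    ConnectedSpace (blowup W).Realization := by
  obtain ⟨R₀, hR₀⟩ := exists_isRegion W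
  have zero_mem : ∀ A : Finset (V ⊕ Fin k), (∀ a ∈ A, (0 : EuclideanSpace ℝ (V ⊕ Fin k)) a ∈
      Set.Icc (0 : ℝ) 1) ∧ ∀ a ∉ A, (0 : EuclideanSpace ℝ (V ⊕ Fin k)) a = 0 := by simp
  have hpath : ∀ c d : (blowup W).Cell, Relation.ReflTransGen (fun p q : (blowup W).Cell =>
      ∃ (e : (blowup W).Edge) (ε : Bool), e.label ∈ Set.univ ∧ e.endpoint ε = p ∧
        e.endpoint (!ε) = q) c d → ∀ s t, connectedComponent ((blowup W).charMap c s) =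
        connectedComponent ((blowup W).charMap d t) := by
    intro c d h
    induction h with
    | refl => exact connectedComponent_charMap_eq c
    | tail _ h ih =>
      rintro s t
      obtain ⟨e, ε, -, rfl, rfl⟩ := h
      refine (ih s ⟨0, zero_mem _⟩).trans ?_
      exact (connectedComponent_face_eq e.cell e.label _ ε ⟨0, zero_mem _⟩ _).trans
        (connectedComponent_face_eq e.cell e.label _ (!ε) ⟨0, zero_mem _⟩ t).symm
  set p₀ := (blowup W).charMap (blowupVertex W R₀ hR₀) ⟨0, zero_mem _⟩
  have hall : ∀ p, p ∈ connectedComponent p₀ := by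
    intro p
    obtain ⟨⟨c, s⟩, rfl⟩ := Quot.exists_rep p
    obtain ⟨R, hR, h⟩ := exists_vertex_connectedComponent_eq c s
    have h1 := (joinedByPathLabelledIn_blowupVertex hW hR hR₀).2.2
    have h2 := hpath _ _ (h1.lift id fun p q ⟨e, ε, _, h3⟩ => ⟨e, ε, trivial, h3⟩)
      ⟨0, zero_mem _⟩ ⟨0, zero_mem _⟩
    exact ((h _).trans h2).subst (motive := fun C => (blowup W).charMap c s ∈ C)
      mem_connectedComponent
  have : Nonempty (blowup W).Realization := ⟨p₀⟩
  have : PreconnectedSpace (blowup W).Realization :=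
    ⟨Set.eq_univ_of_forall hall ▸ isPreconnected_connectedComponent⟩
  exact ⟨inferInstance⟩

end LocalGeometry

end WhiteheadPartition

theorem mainTheorem8 {V : Type u} [Fintype V] [DecidableEq V] (Γ : SimpleGraph V) (k : ℕ)
    (W : Fin k → WhiteheadPartition Γ) (hW : IsCompatibleSet W) :
    (∀ (R R' : Fin k → Bool) (hR : WhiteheadPartition.IsRegion W R)
        (hR' : WhiteheadPartition.IsRegion W R'),
      (WhiteheadPartition.blowup W).JoinedByPathLabelledIn
        {l | ∃ i : Fin k, l = Sum.inr i ∧ R i ≠ R' i}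
        (WhiteheadPartition.blowupVertex W R hR) (WhiteheadPartition.blowupVertex W R' hR')) ∧
    (∀ e f : (WhiteheadPartition.blowup W).Edge, e.label = f.label →
      ∃ H : (WhiteheadPartition.blowup W).Hyperplane, e.IsDualTo H ∧ f.IsDualTo H) ∧
    ConnectedSpace (WhiteheadPartition.blowup W).Realization ∧
    IsLocallyCAT0 (WhiteheadPartition.blowup W).Realization := by
  refine ⟨fun R R' hR hR' => WhiteheadPartition.joinedByPathLabelledIn_blowupVertex hW hR hR',
    fun e f h => ⟨_, rfl, ?_⟩, WhiteheadPartition.connectedSpace_blowup hW,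
    WhiteheadPartition.isLocallyCAT0_blowup⟩
  exact (WhiteheadPartition.edge_mk_eq_of_label_eq hW e f h).symm
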